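/- **Setting.** Let $\alpha\in W^{1,\infty}(\mathbb R,[0,1))$. Let $H^1(\mathbb R)$-functions be identified with their continuous representatives, let $\phi^\pm\in C^\infty(\mathbb R,[0,1])$ with $\phi^++\phi^-=1$, $\operatorname{supp}\phi^+\subset(-1,\infty)$, $\operatorname{supp}\phi^-\subset(-\infty,1)$, and put $E_2=H^1(\mathbb R)+\mathbb R\phi^++\mathbb R\phi^-$ and $E_1^0=L^2(\mathbb R)+\mathbb R\phi^+$. The set $\mathcal D_0^\alpha$ consists of all triplets $(u,\mu,\nu)$ with $u\in E_2$, $\mu=\nu$ a finite positive Radon measure on $\mathbb R$ whose absolutely continuous part is $d\mu_{\rm ac}=u_x^2\,dx$, and $\mu((-\infty,\cdot))\in E_1^0$. *Projection.* For $\Delta x>0$ let $x_j=j\Delta x$, $f_j=f(x_j)$, $Df_{2j}=\frac{f_{2j+2}-f_{2j}}{2\Delta x}$. For $(u,\mu,\nu)\in\mathcal D_0^\alpha$ let $F_{\rm ac}(x)=\mu_{\rm ac}((-\infty,x))$, $F_{\rm sing}(x)=\mu_{\rm sing}((-\infty,x))$ and $q_{2j}=\sqrt{DF_{{\rm ac},2j}-(Du_{2j})^2}$.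 For any choice of signs $\sigma_j\in\{1,-1\}$, $j\in\mathbb Z$, let $P_{\Delta x}((u,\mu,\nu))=(u_{\Delta x},\mu_{\Delta x},\nu_{\Delta x})$, where $\mu_{\Delta x}=\nu_{\Delta x}$ is the measure with $\mu_{\Delta x}((-\infty,x))=F_{\Delta x,\rm ac}(x)+F_{\Delta x,\rm sing}(x)$ and $$u_{\Delta x}(x)=\begin{cases}u_{2j}+(Du_{2j}-\sigma_jq_{2j})(x-x_{2j}),&x_{2j}<x\le x_{2j+1},\\u_{2j+2}+(Du_{2j}+\sigma_jq_{2j})(x-x_{2j+2}),&x_{2j+1}<x\le x_{2j+2},\end{cases}$$ $$F_{\Delta x,\rm ac}(x)=\begin{cases}F_{{\rm ac},2j}+(Du_{2j}-\sigma_jq_{2j})^2(x-x_{2j}),&x_{2j}<x\le x_{2j+1},\\\frac12(F_{{\rm ac},2j+2}+F_{{\rm ac},2j})-2\sigma_jDu_{2j}q_{2j}\Delta x+(Du_{2j}+\sigma_jq_{2j})^2(x-x_{2j+1}),&x_{2j+1}<x\le x_{2j+2},\end{cases}$$ and $F_{\Delta x,\rm sing}(x)=F_{{\rm sing},2j+2}$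 for $x_{2j}<x\le x_{2j+2}$. *Lagrangian coordinates.* Let $L((u,\mu,\nu))=(y,U,V,H)$ with $y(\xi)=\sup\{x\mid x+\nu((-\infty,x))<\xi\}$, $U=u\circ y$, $H(\xi)=\xi-y(\xi)$, $V(\xi)=\int_{-\infty}^\xi\frac{d\mu}{d\nu}(y(\eta))H_\xi(\eta)\,d\eta$. For $X=(y,U,V,H)$ and $f:\mathbb R\to\mathbb R$ write $X\bullet f=(y\circ f,U\circ f,V\circ f,H\circ f)$. *Evolution.* For initial data $\bar X=(\bar y,\bar U,\bar V,\bar H)$ let $\tau(\xi)=0$ if $\bar y_\xi(\xi)=\bar U_\xi(\xi)=0$, $\tau(\xi)=-2\bar y_\xi(\xi)/\bar U_\xi(\xi)$ if $\bar U_\xi(\xi)<0$, and $\tau(\xi)=\infty$ otherwise. Then $S_t(\bar X)=X(t)=(y,U,V,H)(t)$, $t\ge0$, denotes the solution of $$y_t=U,\qquad U_t=\tfrac12V-\tfrac14\lim_{\eta\to\infty}V(t,\eta),\qquad H_t=0,$$ $$V(t,\xi)=\int_{-\infty}^\xi\bigl(1-\alpha(y(\tau(\eta),\eta))\chi_{\{\omega\mid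 t\ge\tau(\omega)>0\}}(\eta)\bigr)\bar V_\xi(\eta)\,d\eta$$ with $X(0)=\bar X$ (the equation for $U$ is understood in integrated form, and $y(t,\cdot)$ is continuous). **Theorem 3.7.** Let $(\bar u,\bar\mu,\bar\nu)\in\mathcal D_0^\alpha$, $\Delta x>0$, $t\ge0$, and let $\bar X=(\bar y,\bar U,\bar V,\bar H)=L((\bar u,\bar\mu,\bar\nu))$ and $\bar X_{\Delta x}=(\bar y_{\Delta x},\bar U_{\Delta x},\bar V_{\Delta x},\bar H_{\Delta x})=L\circ P_{\Delta x}((\bar u,\bar\mu,\bar\nu))$, for any choice of signs in $P_{\Delta x}$. Let $X(s)=S_s(\bar X)$ and $\hat X_{\Delta x}(s)=S_s(\bar X_{\Delta x})$, with energy components $V$ and $\hat V_{\Delta x}$. Define $$\phi(r)=\sup\{\xi\mid\bar y(\xi')<\bar y_{\Delta x}(2r-\xi')\text{ for all }\xi'<\xi\},\qquad\psi(r)=2r-\phi(r),$$ let $\mathcal V$ and $\hat{\mathcal V}_{\Delta x}$ be the energy components of $X(s)\bullet\phi$ and $\hat X_{\Delta x}(s)\bullet\psi$, and let $\mathcal B=\{r\mid(\bar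 y\circ\phi)'(r)=0\}$. Then, for every $\xi\in\mathbb R$, the integrals on the left-hand side below exist (the inner ones for every $s\in[0,t]$) and $$\biggl|\int_0^t\Bigl(\int_{-\infty}^\xi(V_\xi-\hat V_{\Delta x,\xi})(s,\eta)\,d\eta-\int_\xi^\infty(V_\xi-\hat V_{\Delta x,\xi})(s,\eta)\,d\eta\Bigr)ds\biggr|\le4t\Delta x+4t\,\|\delta_{2\Delta x}\bar u_x^2\|_{L^1(\mathbb R)}+\int_0^t\|\mathcal V_r(s)-\hat{\mathcal V}_{\Delta x,r}(s)\|_{L^1(\mathcal B^c)}\,ds,$$ where $\delta_{2\Delta x}f(x)=f(x+2\Delta x)-f(x)$. -/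

import Mathlib

open MeasureTheory Set Filter Topology
open scoped ENNReal

noncomputable section

namespace HunterSaxton

/-! ### Function spaces and Eulerian coordinates -/

/-- `α ∈ W^{1,∞}(ℝ, [0,1))`, given by its (Lipschitz) continuous representative. -/
def IsDissipationCoeff (α : ℝ → ℝ) : Prop :=
  (∃ K, LipschitzWith K α) ∧ ∀ x, α x ∈ Ico (0 : ℝ) 1

/-- `f` is the continuous representative of an element of `H¹(ℝ)`: it lies in `L²`, is absolutely
continuous on every bounded interval, and its (a.e. defined) derivative lies in `L²`. -/
def MemH1 (f : ℝ → ℝ) : Prop :=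
  MemLp f 2 volume ∧ (∀ a b, AbsolutelyContinuousOnInterval f a b) ∧ MemLp (deriv f) 2 volume

/-- A smooth partition of unity `(φ⁺, φ⁻)` subordinate to `(-1, ∞) ∪ (-∞, 1)`. -/
structure IsPartition (p m : ℝ → ℝ) : Prop where
  smooth_p : ContDiff ℝ (⊤ : ℕ∞) p
  smooth_m : ContDiff ℝ (⊤ : ℕ∞) m
  sum_eq_one : ∀ x, p x + m x = 1
  supp_p : tsupport p ⊆ Ioi (-1)
  supp_m : tsupport m ⊆ Iio 1
  range_p : ∀ x, p x ∈ Icc (0 : ℝ) 1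
  range_m : ∀ x, m x ∈ Icc (0 : ℝ) 1

/-- `E₂ = H¹(ℝ) + ℝ φ⁺ + ℝ φ⁻` (the space does not depend on the partition of unity). -/
def MemE2 (f : ℝ → ℝ) : Prop :=
  ∃ p m f₀ : ℝ → ℝ, ∃ a b : ℝ, IsPartition p m ∧ MemH1 f₀ ∧ ∀ x, f x = f₀ x + a * p x + b * m x

/-- `E₁⁰ = L²(ℝ) + ℝ φ⁺`. -/
def MemE10 (f : ℝ → ℝ) : Prop :=
  ∃ p m f₀ : ℝ → ℝ, ∃ a : ℝ, IsPartition p m ∧ MemLp f₀ 2 volume ∧ ∀ x, f x = f₀ x + a * p x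

/-- The absolutely continuous part of a measure on `ℝ`, with respect to Lebesgue measure. -/
def acPart (μ : Measure ℝ) : Measure ℝ := volume.withDensity (μ.rnDeriv volume)

/-- The singular part of a measure on `ℝ`, with respect to Lebesgue measure. -/
def singPart (μ : Measure ℝ) : Measure ℝ := μ.singularPart volume

/-- The (left-continuous) cumulative function `x ↦ μ((-∞, x))`. -/
def cumul (μ : Measure ℝ) (x : ℝ) : ℝ := μ.real (Iio x)

/-- A triplet `(u, μ, ν)`. -/
structure EulerData where
  u : ℝ → ℝ
  mu : Measure ℝ
  nu : Measure ℝ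

/-- `(u, μ, ν) ∈ 𝒟^α`, the set of Eulerian coordinates. -/
structure EulerData.MemD (d : EulerData) : Prop where
  u_mem : MemE2 d.u
  finite_mu : IsFiniteMeasure d.mu
  finite_nu : IsFiniteMeasure d.nu
  mu_le_nu : d.mu ≤ d.nu
  ac_le_ac : acPart d.mu ≤ acPart d.nu
  ac_eq : acPart d.mu = volume.withDensity (fun x => ENNReal.ofReal ((deriv d.u x) ^ 2))
  cumul_mu : MemE10 (cumul d.mu)
  cumul_nu : MemE10 (cumul d.nu)
  density_pos : ∀ᵐ x ∂d.nu, 0 < d.mu.rnDeriv d.nu x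
  density_one : ∀ᵐ x ∂(acPart d.nu), deriv d.u x < 0 →
    (acPart d.mu).rnDeriv (acPart d.nu) x = 1

/-- `(u, μ, ν) ∈ 𝒟₀^α`. -/
def EulerData.MemD0 (d : EulerData) : Prop := d.MemD ∧ d.mu = d.nu

/-! ### The projection operator -/

/-- The measure `μ` with `μ((-∞, x)) = F x`, for an increasing, left-continuous `F` that vanishes
at `-∞` (see `ofCumul_Iio`). -/
def ofCumul (F : ℝ → ℝ) : Measure ℝ :=
  open scoped Classical in if h : Monotone F then h.stieltjesFunction.measure else 0

theorem ofCumul_Iio (F : ℝ → ℝ) (hF : Monotone F) (hl : ∀ x, ContinuousWithinAt F (Iio x) x)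
    (h0 : Tendsto F atBot (𝓝 0)) (x : ℝ) : ofCumul F (Iio x) = ENNReal.ofReal (F x) := by
  have hbot : Tendsto hF.stieltjesFunction atBot (𝓝 0) := by
    have h1 : Tendsto (fun y : ℝ => F (y + 1)) atBot (𝓝 0) :=
      h0.comp (tendsto_atBot_add_const_right _ _ tendsto_id)
    refine tendsto_of_tendsto_of_tendsto_of_le_of_le h0 h1 (fun y => ?_) (fun y => ?_)
    · rw [hF.stieltjesFunction_eq]; exact hF.le_rightLim le_rfl
    · rw [hF.stieltjesFunction_eq]; exact hF.rightLim_le (by linarith)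
  have hlim : Function.leftLim hF.stieltjesFunction x = F x := by
    apply tendsto_nhds_unique (hF.stieltjesFunction.mono.tendsto_leftLim x)
    have h2 : Tendsto F (𝓝[<] x) (𝓝 (F x)) := hl x
    refine tendsto_of_tendsto_of_tendsto_of_le_of_le' h2 tendsto_const_nhds ?_ ?_
    · exact Eventually.of_forall fun y => by
        rw [hF.stieltjesFunction_eq]; exact hF.le_rightLim le_rfl
    · filter_upwards [self_mem_nhdsWithin] with y hy
      rw [hF.stieltjesFunction_eq]; exact hF.rightLim_le hy
  rw [ofCumul, dif_pos hF, hF.stieltjesFunction.measure_Iio hbot, hlim, sub_zero]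

namespace EulerData

variable (d : EulerData) (Δx : ℝ) (σ : ℤ → ℤˣ)

/-- `Du_{2j} = (u(x_{2j+2}) - u(x_{2j})) / (2Δx)`, where `x_j = jΔx`. -/
def diffU (j : ℤ) : ℝ :=
  (d.u ((2 * j + 2) * Δx) - d.u (2 * j * Δx)) / (2 * Δx)

/-- `DF_{ac,2j}`. -/
def diffFac (j : ℤ) : ℝ :=
  (cumul (acPart d.mu) ((2 * j + 2) * Δx) - cumul (acPart d.mu) (2 * j * Δx)) / (2 * Δx)

/-- `q_{2j}`. -/
def q (j : ℤ) : ℝ := √(d.diffFac Δx j - (d.diffU Δx j) ^ 2)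

/-- The choice of sign in the cell `(x_{2j}, x_{2j+2}]`: the value `1` selects the upper, `-1` the
lower one of the signs `∓` and `±`. -/
def signOf (j : ℤ) : ℝ := ((σ j : ℤ) : ℝ)

/-- The index `j` of the cell `(x_{2j}, x_{2j+2}]` that contains `x`. -/
def cell (x : ℝ) : ℤ := ⌈x / (2 * Δx)⌉ - 1

/-- `u_{Δx}`. -/
def projU (x : ℝ) : ℝ :=
  let j := cell Δx x
  if x ≤ (2 * j + 1) * Δx then
    d.u (2 * j * Δx) + (d.diffU Δx j - signOf σ j * d.q Δx j) * (x - 2 * j * Δx)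
  else
    d.u ((2 * j + 2) * Δx)
      + (d.diffU Δx j + signOf σ j * d.q Δx j) * (x - (2 * j + 2) * Δx)

/-- `F_{Δx,ac}`. -/
def projFac (x : ℝ) : ℝ :=
  let j := cell Δx x
  if x ≤ (2 * j + 1) * Δx then
    cumul (acPart d.mu) (2 * j * Δx)
      + (d.diffU Δx j - signOf σ j * d.q Δx j) ^ 2 * (x - 2 * j * Δx)
  else
    (cumul (acPart d.mu) ((2 * j + 2) * Δx) + cumul (acPart d.mu) (2 * j * Δx)) / 2
      - signOf σ j * (2 * d.diffU Δx j * d.q Δx j * Δx)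
      + (d.diffU Δx j + signOf σ j * d.q Δx j) ^ 2 * (x - (2 * j + 1) * Δx)

/-- `F_{Δx,sing}`. -/
def projFsing (x : ℝ) : ℝ := cumul (singPart d.mu) ((2 * cell Δx x + 2) * Δx)

/-- `F_{Δx} = G_{Δx}`. -/
def projF (x : ℝ) : ℝ := d.projFac Δx σ x + d.projFsing Δx x

/-- The projection operator `P_{Δx}`, for the sign choice `σ`. -/
def proj : EulerData where
  u := d.projU Δx σ
  mu := ofCumul (d.projF Δx σ)
  nu := ofCumul (d.projF Δx σ)

end EulerData

/-! ### Lagrangian coordinates -/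

/-- A quadruplet `X = (y, U, V, H)`. -/
structure LagrData where
  y : ℝ → ℝ
  U : ℝ → ℝ
  V : ℝ → ℝ
  H : ℝ → ℝ

/-- `X • f = (y ∘ f, U ∘ f, V ∘ f, H ∘ f)`. -/
def LagrData.comp (X : LagrData) (f : ℝ → ℝ) : LagrData where
  y := X.y ∘ f
  U := X.U ∘ f
  V := X.V ∘ f
  H := X.H ∘ f

namespace EulerData

variable (d : EulerData)

/-- `y(ξ) = sup {x | x + ν((-∞, x)) < ξ}`. -/
def lagrY (ξ : ℝ) : ℝ := sSup {x : ℝ | x + cumul d.nu x < ξ}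

/-- `H(ξ) = ξ - y(ξ)`. -/
def lagrH (ξ : ℝ) : ℝ := ξ - d.lagrY ξ

/-- The map `L` from Eulerian to Lagrangian coordinates. -/
def toLagr : LagrData where
  y := d.lagrY
  U := fun ξ => d.u (d.lagrY ξ)
  V := fun ξ => ∫ η in Iic ξ, (d.mu.rnDeriv d.nu (d.lagrY η)).toReal * deriv d.lagrH η
  H := d.lagrH

end EulerData

/-- The wave breaking function `τ : ℝ → [0, ∞]` of the initial data `Xbar`. -/
def waveBreaking (Xbar : LagrData) (ξ : ℝ) : ℝ≥0∞ :=
  open scoped Classical in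
  if deriv Xbar.y ξ = 0 ∧ deriv Xbar.U ξ = 0 then 0
  else if deriv Xbar.U ξ < 0 then ENNReal.ofReal (-(2 * deriv Xbar.y ξ / deriv Xbar.U ξ))
  else ∞

/-- `X(t) = S_t(Xbar)` for all `t ≥ 0`: the curve `X` solves the Lagrangian system for
`α`-dissipative solutions with initial data `Xbar`. The equation for `U` is integrated in time,
since `V` may jump in time. The values of `X t` for `t < 0` are irrelevant. -/
structure IsAlphaSolution (α : ℝ → ℝ) (Xbar : LagrData) (X : ℝ → LagrData) : Prop where
  initial : X 0 = Xbar
  continuous_y : ∀ t, 0 ≤ t → Continuous (X t).y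
  y_eq : ∀ ξ, ∀ t, 0 ≤ t → HasDerivWithinAt (fun s => (X s).y ξ) ((X t).U ξ) (Ici 0) t
  U_eq : ∀ ξ, ∀ t, 0 ≤ t → (X t).U ξ =
    Xbar.U ξ + ∫ s in (0 : ℝ)..t, ((1 / 2) * (X s).V ξ - (1 / 4) * limUnder atTop (X s).V)
  V_eq : ∀ ξ, ∀ t, 0 ≤ t → (X t).V ξ =
    ∫ η in Iic ξ,
      (1 - α ((X (waveBreaking Xbar η).toReal).y η) *
          indicator {ω | 0 < waveBreaking Xbar ω ∧ waveBreaking Xbar ω ≤ ENNReal.ofReal t} 1 η)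
        * deriv Xbar.V η
  H_eq : ∀ ξ, ∀ t, 0 ≤ t → (X t).H ξ = Xbar.H ξ

/-! ### The additional change of variables -/

/-- `φ(r) = sup {ξ | y₁(ξ') < y₂(2r - ξ') for all ξ' < ξ}`. -/
def phi (y₁ y₂ : ℝ → ℝ) (r : ℝ) : ℝ := sSup {ξ : ℝ | ∀ ξ' < ξ, y₁ ξ' < y₂ (2 * r - ξ')}

/-- `ψ(r) = 2r - φ(r)`. -/
def psi (y₁ y₂ : ℝ → ℝ) (r : ℝ) : ℝ := 2 * r - phi y₁ y₂ r

/-- `ℬ = {r | 𝒴'(r) = 0}`. -/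
def zeroDerivSet (Y : ℝ → ℝ) : Set ℝ := {r | HasDerivAt Y 0 r}

end HunterSaxton

end

namespace HunterSaxton

/-! ### Monotone and Lipschitz functions on the line -/

/-! Because μ = ν, both Lagrangian energies start as H = ξ - y. At time s they are primitives of
k·H_ξ, where the retained fraction k lies in [0,1] and equals 1 wherever y_ξ = 0 (`isRetained`). The
inner expression of the theorem thus collapses to 2(V - V̂)(ξ) minus the difference of the total
energies, and it is bounded at each fixed time (`energy_le`).

The projection preserves F_ac and F_sing at the grid points x_{2j}. Hence at ξ₀ = x_{2j} + F(x_{2j})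
both y and ŷ equal x_{2j}, and φ(ξ₀) = ψ(ξ₀) = ξ₀. The density on {y_ξ = 0} is carried by y to the
singular part of the measure (`map_lag_densSing`) and is never dissipated, so the singular energies
of the two solutions agree up to ξ₀ and in total, and cancel. The remaining energies, composed with
φ and ψ, are monotone and Lipschitz, hence integrals of their derivatives. These derivatives vanish
a.e. on ℬ and a.e. off ℬ equal those of the full energies, which yields the L¹(ℬᶜ) term
(`energy_le_of_crossing`).

For general ξ, compare with ξ₀ at the left end of the cell containing y(ξ); ŷ(ξ) lies in the same
cell. Writing V = ξ - y - loss, the positions differ by at most 2Δx, and each loss between ξ₀ and ξ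
lies between 0 and the absolutely continuous energy of the cell (`loss_bounds`). That energy is at
most ‖δ_{2Δx} u_x²‖_{L¹}, by telescoping (`ofReal_integral_le_eLpNorm_shift`). Doubling and
integrating in time finishes the proof. -/

theorem ae_deriv_eq_zero_of_mem_null {f : ℝ → ℝ} (hf : Monotone f) {N : Set ℝ}
    (hN : volume N = 0) : ∀ᵐ x, f x ∈ N → deriv f x = 0 := by
  set s : Set ℝ := {x | DifferentiableAt ℝ f x} ∩ f ⁻¹' (toMeasurable volume N) with hs_def
  have hs : MeasurableSet s :=
    (measurableSet_of_differentiableAt ℝ f).inter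
      (hf.measurable (measurableSet_toMeasurable volume N))
  -- Area formula: the integral of f' over a set of differentiability points is the measure of its
  -- image, here contained in a null set.
  have h1 : ∫⁻ x in s, ENNReal.ofReal (deriv f x) = volume (f '' s) :=
    lintegral_deriv_eq_volume_image_of_monotoneOn hs
      (fun x hx => hx.1.hasDerivAt.hasDerivWithinAt) (hf.monotoneOn s)
  have h2 : volume (f '' s) = 0 := by
    refine measure_mono_null (t := toMeasurable volume N) ?_ (by rw [measure_toMeasurable, hN])
    rintro _ ⟨x, hx, rfl⟩
    exact hx.2
  rw [h2, lintegral_eq_zero_iff (measurable_deriv f).ennreal_ofReal] at h1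
  rw [EventuallyEq, ae_restrict_iff' hs] at h1
  filter_upwards [h1] with x hx hxN
  by_cases hd : DifferentiableAt ℝ f x
  · have h3 := hx ⟨hd, subset_toMeasurable volume N hxN⟩
    have h4 : deriv f x ≤ 0 := by simpa using h3
    exact le_antisymm h4 (hf.deriv_nonneg)
  · exact deriv_zero_of_not_differentiableAt hd

theorem ae_deriv_comp_eq_zero_or {f : ℝ → ℝ} (hf : Monotone f) {p : ℝ → Prop}
    (hp : ∀ᵐ x, p x) : ∀ᵐ x, deriv f x = 0 ∨ p (f x) := by
  filter_upwards [ae_deriv_eq_zero_of_mem_null hf (N := {x | ¬ p x}) hp] with x hx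
  by_cases h : p (f x)
  · exact Or.inr h
  · exact Or.inl (hx h)

/-- The outer function need not be differentiable: its increments are O of those of g, which are o(y
- x). -/
theorem hasDerivAt_comp_of_lipschitz {f g : ℝ → ℝ} {K : NNReal} (hf : LipschitzWith K f) {x : ℝ}
    (hg : HasDerivAt g 0 x) : HasDerivAt (f ∘ g) 0 x := by
  rw [hasDerivAt_iff_isLittleO] at hg ⊢
  simp only [smul_zero, sub_zero] at hg ⊢
  refine Asymptotics.IsBigO.trans_isLittleO (Asymptotics.IsBigO.of_bound K ?_) hg
  exact Eventually.of_forall fun y => by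
    simpa [Real.dist_eq] using hf.dist_le_mul (g y) (g x)

/-- The preimage of the bad set of f need not be null, but almost everywhere on it g' = 0, and there
both sides vanish whatever `deriv f` returns. -/
theorem ae_hasDerivAt_comp {f g : ℝ → ℝ} {K L : NNReal} (hf : LipschitzWith K f)
    (hg : LipschitzWith L g) (hgm : Monotone g) :
    ∀ᵐ x, HasDerivAt (f ∘ g) (deriv f (g x) * deriv g x) x := by
  filter_upwards [ae_deriv_comp_eq_zero_or hgm hf.ae_differentiableAt_real,
    hg.ae_differentiableAt_real] with x h1 h2
  rcases h1 with h1 | h1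
  · have h3 := h2.hasDerivAt
    rw [h1] at h3 ⊢
    simpa using hasDerivAt_comp_of_lipschitz hf h3
  · exact h1.hasDerivAt.comp x h2.hasDerivAt

theorem intervalIntegral_deriv_of_lipschitz {G : ℝ → ℝ} {K : NNReal} (hL : LipschitzWith K G)
    (a b : ℝ) : IntervalIntegrable (deriv G) volume a b ∧ ∫ x in a..b, deriv G x = G b - G a := by
  have h : AbsolutelyContinuousOnInterval G a b :=
    (hL.lipschitzOnWith (s := uIcc a b)).absolutelyContinuousOnInterval
  exact ⟨h.intervalIntegrable_deriv, h.integral_deriv_eq_sub⟩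

/-- Absolute continuity gives the fundamental theorem on bounded intervals; since G' ≥ 0, the limits
at ±∞ bound those integrals and make G' integrable. -/
theorem integral_deriv_of_monotone_lipschitz {G : ℝ → ℝ} {K : NNReal} {m : ℝ}
    (hL : LipschitzWith K G) (hm : Monotone G) (hbot : Tendsto G atBot (𝓝 0))
    (htop : Tendsto G atTop (𝓝 m)) :
    Integrable (deriv G) volume ∧ (∀ r, ∫ x in Iic r, deriv G x = G r) ∧
      (∀ r, ∫ x in Ioi r, deriv G x = m - G r) := by
  have h0 : ∀ x, 0 ≤ G x := fun x => hm.le_of_tendsto hbot x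
  have h1 : ∀ x, G x ≤ m := fun x => hm.ge_of_tendsto htop x
  have hint : Integrable (deriv G) volume := by
    refine integrable_of_intervalIntegral_norm_bounded (a := fun n : ℕ => -(n : ℝ))
      (b := fun n : ℕ => (n : ℝ)) (l := atTop) m (fun n => ?_)
      (tendsto_neg_atTop_atBot.comp tendsto_natCast_atTop_atTop) tendsto_natCast_atTop_atTop ?_
    · have h2 := (intervalIntegral_deriv_of_lipschitz hL (-(n : ℝ)) n).1
      rwa [intervalIntegrable_iff_integrableOn_Ioc_of_le (by
        have : (0 : ℝ) ≤ n := n.cast_nonneg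
        linarith)] at h2
    · refine Eventually.of_forall fun n => ?_
      have h2 : ∀ x, ‖deriv G x‖ = deriv G x := fun x => by
        rw [Real.norm_eq_abs, abs_of_nonneg hm.deriv_nonneg]
      simp only [h2, (intervalIntegral_deriv_of_lipschitz hL _ _).2]
      linarith [h0 (-(n : ℝ)), h1 n]
  refine ⟨hint, fun r => ?_, fun r => ?_⟩
  · have h2 := intervalIntegral_tendsto_integral_Iic r hint.integrableOn tendsto_id
    refine tendsto_nhds_unique h2 ?_
    simp only [(intervalIntegral_deriv_of_lipschitz hL _ _).2]
    simpa using tendsto_const_nhds.sub hbot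
  · have h2 := intervalIntegral_tendsto_integral_Ioi r hint.integrableOn tendsto_id
    refine tendsto_nhds_unique h2 ?_
    simp only [(intervalIntegral_deriv_of_lipschitz hL _ _).2]
    exact htop.sub tendsto_const_nhds

/-! ### Primitives of integrable functions -/

/-- The primitive of `g` that vanishes at `-∞`. -/
noncomputable def prim (g : ℝ → ℝ) (ξ : ℝ) : ℝ := ∫ η in Iic ξ, g η

theorem prim_sub {g : ℝ → ℝ} (hg : Integrable g volume) (a b : ℝ) :
    prim g b - prim g a = ∫ x in a..b, g x :=
  intervalIntegral.integral_Iic_sub_Iic hg.integrableOn hg.integrableOn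

theorem prim_mono {g : ℝ → ℝ} (hg : Integrable g volume) (h0 : ∀ x, 0 ≤ g x) :
    Monotone (prim g) := fun a b hab => by
  have h := prim_sub hg a b
  have h2 : 0 ≤ ∫ x in a..b, g x := intervalIntegral.integral_nonneg hab fun x _ => h0 x
  linarith

theorem prim_nonneg {g : ℝ → ℝ} (h0 : ∀ x, 0 ≤ g x) (ξ : ℝ) : 0 ≤ prim g ξ :=
  integral_nonneg h0

theorem prim_lipschitz {g : ℝ → ℝ} (hg : Integrable g volume) (h1 : ∀ x, |g x| ≤ 1) :
    LipschitzWith 1 (prim g) := by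
  refine LipschitzWith.of_dist_le_mul fun a b => ?_
  rw [Real.dist_eq, prim_sub hg b a, Real.dist_eq]
  simpa using intervalIntegral.norm_integral_le_of_norm_le_const (f := g) (a := b) (b := a)
    (C := 1) fun x _ => h1 x

theorem prim_tendsto_atBot {g : ℝ → ℝ} (hg : Integrable g volume) :
    Tendsto (prim g) atBot (𝓝 0) := by
  have h2 := intervalIntegral_tendsto_integral_Iic 0 hg.integrableOn tendsto_id
  have h3 : Tendsto (fun a => prim g 0 - ∫ x in a..(0 : ℝ), g x) atBot (𝓝 (prim g 0 - prim g 0)) :=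
    tendsto_const_nhds.sub h2
  rw [sub_self] at h3
  refine h3.congr fun a => ?_
  rw [← prim_sub hg]; ring

theorem prim_tendsto_atTop {g : ℝ → ℝ} (hg : Integrable g volume) :
    Tendsto (prim g) atTop (𝓝 (∫ x, g x)) := by
  have h2 := intervalIntegral_tendsto_integral_Ioi 0 hg.integrableOn tendsto_id
  have h3 := h2.const_add (prim g 0)
  rw [prim, intervalIntegral.integral_Iic_add_Ioi hg.integrableOn hg.integrableOn] at h3
  refine h3.congr fun a => ?_
  have := prim_sub hg 0 a
  simp only [prim, id] at *
  linarith

theorem prim_ae_deriv {g : ℝ → ℝ} (hg : Integrable g volume) :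
    ∀ᵐ x, HasDerivAt (prim g) (g x) x := by
  filter_upwards [LocallyIntegrable.ae_hasDerivAt_integral hg.locallyIntegrable] with x hx
  have h := (hx 0).const_add (prim g 0)
  refine h.congr_of_eventuallyEq (Eventually.of_forall fun a => ?_)
  have := prim_sub hg 0 a
  simp only at *
  linarith

theorem prim_comp_ae_hasDerivAt {g φ : ℝ → ℝ} {L : NNReal} (hg : Integrable g volume)
    (h1 : ∀ x, |g x| ≤ 1) (hφ : LipschitzWith L φ) (hφm : Monotone φ) :
    ∀ᵐ x, HasDerivAt (prim g ∘ φ) (g (φ x) * deriv φ x) x := by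
  filter_upwards [ae_hasDerivAt_comp (prim_lipschitz hg h1) hφ hφm,
    ae_deriv_comp_eq_zero_or hφm (prim_ae_deriv hg)] with x h2 h3
  rcases h3 with h3 | h3
  · rw [h3, mul_zero] at h2 ⊢
    exact h2
  · rwa [h3.deriv] at h2

/-- A Carathéodory argument: continuity in time and measurability in ξ give joint measurability.
Clamping time at 0 avoids negative times, where nothing is known. -/
theorem measurable_uncurry_of_differentiable_on_nonneg {Y Y' : ℝ → ℝ → ℝ}
    (hc : ∀ t, 0 ≤ t → Continuous (Y t))
    (hd : ∀ ξ, ∀ t, 0 ≤ t → HasDerivWithinAt (fun s => Y s ξ) (Y' t ξ) (Ici 0) t) :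
    Measurable fun p : ℝ × ℝ => Y (max p.1 0) p.2 := by
  refine measurable_uncurry_of_continuous_of_measurable (u := fun t ξ => Y (max t 0) ξ)
    (fun ξ => ?_) (fun t => (hc _ (le_max_right _ _)).measurable)
  have h : ContinuousOn (fun s => Y s ξ) (Ici 0) := fun t ht => (hd ξ t ht).continuousWithinAt
  exact h.comp_continuous (continuous_id.max continuous_const) fun t => mem_Ici.2 (le_max_right _ _)

/-! ### Cumulative functions -/

theorem Measure.ext_of_Iio {μ ν : Measure ℝ} [IsFiniteMeasure μ] [IsFiniteMeasure ν]
    (h : ∀ x, μ (Iio x) = ν (Iio x)) : μ = ν := by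
  refine Measure.ext_of_Ico μ ν fun a b hab => ?_
  have h1 : Ico a b = Iio b \ Iio a := by ext x; simp
  rw [h1, measure_sdiff (Iio_subset_Iio hab.le) nullMeasurableSet_Iio (measure_ne_top _ _),
    measure_sdiff (Iio_subset_Iio hab.le) nullMeasurableSet_Iio (measure_ne_top _ _), h, h]

theorem lipschitz_of_monotone_of_monotone_sub {K : NNReal} {f : ℝ → ℝ} (hf : Monotone f)
    (hg : Monotone fun x => K * x - f x) : LipschitzWith K f := by
  refine LipschitzWith.of_le_add_mul K fun x y => ?_
  rcases le_total x y with h | h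
  · exact (hf h).trans (le_add_of_nonneg_right (by positivity))
  · have := hg h
    rw [Real.dist_eq, abs_of_nonneg (by linarith), mul_sub]
    simp only at this
    linarith

/-- The generalized inverse of `x ↦ x + ν((-∞, x))`. -/
noncomputable def lag (ν : Measure ℝ) (ξ : ℝ) : ℝ := sSup {x : ℝ | x + cumul ν x < ξ}

/-- The Lagrangian cumulative energy. -/
noncomputable def lagH (ν : Measure ℝ) (ξ : ℝ) : ℝ := ξ - lag ν ξ

/-- The density of the energy in Lagrangian coordinates. -/
noncomputable def dens (ν : Measure ℝ) : ℝ → ℝ := deriv (lagH ν)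

/-- The density of the singular energy, which lives on `{y_ξ = 0}`. -/
noncomputable def densSing (ν : Measure ℝ) : ℝ → ℝ :=
  indicator {η | deriv (lag ν) η = 0} (dens ν)

theorem measurable_dens (ν : Measure ℝ) : Measurable (dens ν) := measurable_deriv _

theorem measurableSet_deriv_lag (ν : Measure ℝ) : MeasurableSet {η | deriv (lag ν) η = 0} :=
  measurable_deriv (lag ν) (measurableSet_singleton 0)

theorem cumul_nonneg (ν : Measure ℝ) (x : ℝ) : 0 ≤ cumul ν x := measureReal_nonneg

section Cumul

variable (ν : Measure ℝ) [IsFiniteMeasure ν]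

theorem cumul_mono : Monotone (cumul ν) := fun _ _ h => measureReal_mono (Iio_subset_Iio h)

theorem cumul_le (x : ℝ) : cumul ν x ≤ ν.real univ := measureReal_mono (subset_univ _)

theorem ofReal_cumul (x : ℝ) : ENNReal.ofReal (cumul ν x) = ν (Iio x) :=
  ofReal_measureReal

theorem cumul_tendsto_atBot : Tendsto (cumul ν) atBot (𝓝 0) := by
  have h1 : Tendsto (fun x : ℝ => ν.real (Ici x)) atBot (𝓝 (ν.real univ)) :=
    (ENNReal.tendsto_toReal (measure_ne_top _ _)).comp (tendsto_measure_Ici_atBot ν)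
  have h2 := h1.const_sub (ν.real univ)
  rw [sub_self] at h2
  refine h2.congr fun x => ?_
  rw [← compl_Iio, measureReal_compl measurableSet_Iio, cumul]
  ring

theorem cumul_tendsto_atTop : Tendsto (cumul ν) atTop (𝓝 (ν.real univ)) := by
  have h : Tendsto (fun x => ν.real (Iic (x - 1))) atTop (𝓝 (ν.real univ)) := by
    have h1 := tendsto_measure_Iic_atTop ν
    have h2 : Tendsto (fun x : ℝ => ν.real (Iic x)) atTop (𝓝 (ν.real univ)) :=
      (ENNReal.tendsto_toReal (measure_ne_top _ _)).comp h1
    exact h2.comp (tendsto_atTop_add_const_right _ (-1) tendsto_id)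
  refine tendsto_of_tendsto_of_tendsto_of_le_of_le h tendsto_const_nhds (fun x => ?_) (cumul_le ν)
  exact measureReal_mono fun y (hy : y ≤ x - 1) => mem_Iio.2 (by linarith)

/-- Left continuity of the cumulative function, from continuity of the measure along increasing
unions. -/
theorem exists_lt_cumul {x c : ℝ} (h : c < cumul ν x) : ∃ y < x, c < cumul ν y := by
  obtain ⟨u, hu, hux, hlim⟩ := exists_seq_strictMono_tendsto x
  have h1 : ⋃ n, Iio (u n) = Iio x := by
    ext z
    simp only [mem_iUnion, mem_Iio]
    exact ⟨fun ⟨n, hn⟩ => hn.trans (hux n), fun hz => (hlim.eventually_const_lt hz).exists⟩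
  have h2 := tendsto_measure_iUnion_atTop (μ := ν) (s := fun n => Iio (u n))
    fun a b hab => Iio_subset_Iio (hu.monotone hab)
  rw [h1] at h2
  have h3 : Tendsto (fun n => cumul ν (u n)) atTop (𝓝 (cumul ν x)) :=
    (ENNReal.tendsto_toReal (measure_ne_top _ _)).comp h2
  obtain ⟨n, hn⟩ := (h3.eventually_const_lt h).exists
  exact ⟨u n, hux n, hn⟩

theorem acPart_add_singPart : acPart ν + singPart ν = ν := Measure.rnDeriv_add_singularPart ν volume

instance : IsFiniteMeasure (singPart ν) := by unfold singPart; infer_instance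

instance : IsFiniteMeasure (acPart ν) := by unfold acPart; infer_instance

theorem cumul_acPart_add_singPart (x : ℝ) :
    cumul (acPart ν) x + cumul (singPart ν) x = cumul ν x := by
  conv_rhs => rw [← acPart_add_singPart ν]
  exact (measureReal_add_apply (μ₁ := acPart ν) (μ₂ := singPart ν) (s := Iio x)).symm

/-! ### The Lagrangian variable -/

/-- The Galois connection between y and x + F(x), from which the properties of y are derived. Left
continuity of F makes the non-strict form valid. -/
theorem le_lag_iff {x ξ : ℝ} : x ≤ lag ν ξ ↔ x + cumul ν x ≤ ξ := by
  have hb : BddAbove {x : ℝ | x + cumul ν x < ξ} :=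
    ⟨ξ, fun z (hz : z + cumul ν z < ξ) => by linarith [cumul_nonneg ν z]⟩
  have hn : {x : ℝ | x + cumul ν x < ξ}.Nonempty :=
    ⟨ξ - ν.real univ - 1, by
      change ξ - ν.real univ - 1 + cumul ν (ξ - ν.real univ - 1) < ξ
      linarith [cumul_le ν (ξ - ν.real univ - 1)]⟩
  constructor
  · intro h
    by_contra! h1
    obtain ⟨y, hy, hy2⟩ : ∃ y < x, ξ < y + cumul ν y := by
      -- The excess x + F(x) - ξ is split in halves: one allows for the drop in F, the other for the
      -- drop in position.
      obtain ⟨y, hy, hy2⟩ := exists_lt_cumul ν (x := x) (c := ξ - x + (x + cumul ν x - ξ) / 2)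
        (by linarith)
      refine ⟨max y (x - (x + cumul ν x - ξ) / 2), max_lt hy (by linarith), ?_⟩
      have h2 := cumul_mono ν (le_max_left y (x - (x + cumul ν x - ξ) / 2))
      have h3 := le_max_right y (x - (x + cumul ν x - ξ) / 2)
      linarith
    have h2 : lag ν ξ ≤ y := csSup_le hn fun z (hz : z + cumul ν z < ξ) => by
      by_contra! hzy
      linarith [cumul_mono ν hzy.le]
    linarith
  · intro h
    refine le_of_forall_lt_imp_le_of_dense fun z hz => le_csSup hb ?_
    change z + cumul ν z < ξ
    linarith [cumul_mono ν hz.le]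

theorem lag_lt_iff {x ξ : ℝ} : lag ν ξ < x ↔ ξ < x + cumul ν x := by
  rw [← not_le, le_lag_iff, not_le]

theorem lag_mono : Monotone (lag ν) := fun _ _ h =>
  (le_lag_iff ν).2 (((le_lag_iff ν).1 le_rfl).trans h)

/-- Since F is increasing, x + F(x) grows at least as fast as x, so its inverse grows at most at
unit rate. -/
theorem lag_add_le {ξ δ : ℝ} (hδ : 0 ≤ δ) : lag ν (ξ + δ) ≤ lag ν ξ + δ := by
  have h1 := (le_lag_iff ν).1 (le_refl (lag ν (ξ + δ)))
  have h2 : lag ν (ξ + δ) - δ ≤ lag ν ξ := (le_lag_iff ν).2 (by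
    have := cumul_mono ν (show lag ν (ξ + δ) - δ ≤ lag ν (ξ + δ) by linarith)
    linarith)
  linarith

theorem lagH_mono : Monotone (lagH ν) := fun ξ ξ' h => by
  have := lag_add_le ν (ξ := ξ) (δ := ξ' - ξ) (by linarith)
  rw [add_sub_cancel] at this
  unfold lagH
  linarith

theorem lag_lipschitz : LipschitzWith 1 (lag ν) :=
  lipschitz_of_monotone_of_monotone_sub (lag_mono ν) (by simpa using! lagH_mono ν)

theorem lagH_lipschitz : LipschitzWith 1 (lagH ν) :=
  lipschitz_of_monotone_of_monotone_sub (lagH_mono ν) (by simpa [lagH] using! lag_mono ν)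

theorem lag_le_self (ξ : ℝ) : lag ν ξ ≤ ξ := by
  linarith [(le_lag_iff ν).1 (le_refl (lag ν ξ)), cumul_nonneg ν (lag ν ξ)]

theorem sub_le_lag (ξ : ℝ) : ξ - ν.real univ ≤ lag ν ξ :=
  (le_lag_iff ν).2 (by linarith [cumul_le ν (ξ - ν.real univ)])

theorem lag_add_cumul (x : ℝ) : lag ν (x + cumul ν x) = x := by
  refine le_antisymm (le_of_forall_gt_imp_ge_of_dense fun z hz => ?_) ((le_lag_iff ν).2 le_rfl)
  exact ((lag_lt_iff ν).2 (by linarith [cumul_mono ν hz.le])).le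

theorem lagH_add_cumul (x : ℝ) : lagH ν (x + cumul ν x) = cumul ν x := by
  rw [lagH, lag_add_cumul]; ring

theorem lagH_nonneg (ξ : ℝ) : 0 ≤ lagH ν ξ := sub_nonneg.2 (lag_le_self ν ξ)

/-- H(ξ) is at most the right limit of F at y(ξ), and y(ξ) ≤ ξ; the shift by 1 leaves room for that
right limit. -/
theorem lagH_le (ξ : ℝ) : lagH ν ξ ≤ cumul ν (ξ + 1) := by
  refine le_of_forall_pos_lt_add fun ε hε => ?_
  have h1 : lag ν ξ < lag ν ξ + min ε 1 := by
    have : 0 < min ε 1 := lt_min hε one_pos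
    linarith
  rw [lag_lt_iff] at h1
  have h2 : cumul ν (lag ν ξ + min ε 1) ≤ cumul ν (ξ + 1) :=
    cumul_mono ν (add_le_add (lag_le_self ν ξ) (min_le_right _ _))
  unfold lagH
  linarith [min_le_left ε 1]

theorem lagH_tendsto_atBot : Tendsto (lagH ν) atBot (𝓝 0) :=
  squeeze_zero (lagH_nonneg ν) (lagH_le ν)
    ((cumul_tendsto_atBot ν).comp (tendsto_atBot_add_const_right _ 1 tendsto_id))

theorem lagH_tendsto_atTop : Tendsto (lagH ν) atTop (𝓝 (ν.real univ)) := by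
  have h : Tendsto (fun ξ => cumul ν (ξ + -ν.real univ)) atTop (𝓝 (ν.real univ)) :=
    (cumul_tendsto_atTop ν).comp (tendsto_atTop_add_const_right _ _ tendsto_id)
  refine tendsto_of_tendsto_of_tendsto_of_le_of_le h tendsto_const_nhds (fun ξ => ?_)
    fun ξ => (lagH_le ν ξ).trans (cumul_le ν _)
  have h1 := cumul_mono ν (sub_le_lag ν ξ)
  have h2 := (le_lag_iff ν).1 (le_refl (lag ν ξ))
  unfold lagH
  simp only [← sub_eq_add_neg]
  linarith

/-! ### The Lagrangian energy density and its singular part -/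

theorem dens_nonneg (ξ : ℝ) : 0 ≤ dens ν ξ := (lagH_mono ν).deriv_nonneg

theorem dens_le_one (ξ : ℝ) : dens ν ξ ≤ 1 := by
  have := norm_deriv_le_of_lipschitz (lagH_lipschitz ν) (x₀ := ξ)
  exact (le_abs_self _).trans (by simpa [dens] using this)

theorem integrable_dens : Integrable (dens ν) volume :=
  (integral_deriv_of_monotone_lipschitz (lagH_lipschitz ν) (lagH_mono ν) (lagH_tendsto_atBot ν)
    (lagH_tendsto_atTop ν)).1

theorem prim_dens : prim (dens ν) = lagH ν := funext
  (integral_deriv_of_monotone_lipschitz (lagH_lipschitz ν) (lagH_mono ν) (lagH_tendsto_atBot ν)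
    (lagH_tendsto_atTop ν)).2.1

/-- The preimage of a left half-line under y is again one, ending at x + F(x), so Lagrangian
primitives become Eulerian cumulative functions. -/
theorem map_lag_apply_Iio {g : ℝ → ℝ} (hg : Integrable g volume) (h0 : ∀ x, 0 ≤ g x) (x : ℝ) :
    (volume.withDensity fun η => ENNReal.ofReal (g η)).map (lag ν) (Iio x)
      = ENNReal.ofReal (prim g (x + cumul ν x)) := by
  have h1 : lag ν ⁻¹' Iio x = Iio (x + cumul ν x) := by
    ext ξ; exact lag_lt_iff ν
  rw [Measure.map_apply (lag_lipschitz ν).continuous.measurable measurableSet_Iio, h1,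
    withDensity_apply _ measurableSet_Iio, prim, integral_Iic_eq_integral_Iio,
    ofReal_integral_eq_lintegral_ofReal hg.integrableOn (Eventually.of_forall h0)]

theorem map_lag_dens :
    (volume.withDensity fun η => ENNReal.ofReal (dens ν η)).map (lag ν) = ν := by
  have : IsFiniteMeasure (volume.withDensity fun η => ENNReal.ofReal (dens ν η)) :=
    isFiniteMeasure_withDensity_ofReal (integrable_dens ν).2
  refine Measure.ext_of_Iio fun x => ?_
  rw [map_lag_apply_Iio ν (integrable_dens ν) (dens_nonneg ν), prim_dens, lagH_add_cumul,
    ofReal_cumul]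

theorem densSing_nonneg (ξ : ℝ) : 0 ≤ densSing ν ξ :=
  indicator_nonneg (fun x _ => dens_nonneg ν x) ξ

theorem integrable_densSing : Integrable (densSing ν) volume :=
  (integrable_dens ν).indicator (measurableSet_deriv_lag ν)

/-- By the area formula y maps {y_ξ = 0} into a null set, up to the null set of
non-differentiability. Off that set, preimages of null sets are null, so the image measure is
absolutely continuous. Uniqueness of the Lebesgue decomposition identifies the two parts. -/
theorem map_lag_densSing :
    (volume.withDensity fun η => ENNReal.ofReal (densSing ν η)).map (lag ν) = singPart ν := by
  set S := {η | deriv (lag ν) η = 0} with hS_def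
  have hS : MeasurableSet S := measurableSet_deriv_lag ν
  set m := volume.withDensity fun η => ENNReal.ofReal (dens ν η) with hm
  have hmfin : IsFiniteMeasure m := isFiniteMeasure_withDensity_ofReal (integrable_dens ν).2
  have hml : Measurable (lag ν) := (lag_lipschitz ν).continuous.measurable
  have h1 : (volume.withDensity fun η => ENNReal.ofReal (densSing ν η)) = m.restrict S := by
    rw [hm, restrict_withDensity hS, ← withDensity_indicator hS]
    congr 1
    ext η
    by_cases h : η ∈ S <;> simp [densSing, h, ← hS_def]
  have hac : (m.restrict Sᶜ).map (lag ν) ≪ volume := by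
    refine Measure.AbsolutelyContinuous.mk fun N hN hN0 => ?_
    rw [Measure.map_apply hml hN, Measure.restrict_apply (hml hN)]
    have h2 : volume (lag ν ⁻¹' N ∩ Sᶜ) = 0 := by
      have h3 := ae_deriv_eq_zero_of_mem_null (lag_mono ν) hN0
      refine measure_mono_null (fun x hx => ?_) h3
      simpa using! hx
    exact withDensity_absolutelyContinuous _ _ h2
  have hsing : (m.restrict S).map (lag ν) ⟂ₘ volume := by
    set D := {x | DifferentiableAt ℝ (lag ν) x} with hD_def
    have hD : MeasurableSet D := measurableSet_of_differentiableAt ℝ (lag ν)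
    have h2 : volume (lag ν '' (S ∩ D)) = 0 := by
      rw [← lintegral_deriv_eq_volume_image_of_monotoneOn (hS.inter hD)
        (fun x hx => hx.2.hasDerivAt.hasDerivWithinAt) ((lag_mono ν).monotoneOn _)]
      refine (setLIntegral_congr_fun (hS.inter hD) (g := 0) fun x hx => ?_).trans (by simp)
      simp [show deriv (lag ν) x = 0 from hx.1]
    have hN := measurableSet_toMeasurable volume (lag ν '' (S ∩ D))
    refine ⟨(toMeasurable volume (lag ν '' (S ∩ D)))ᶜ, hN.compl, ?_, by
      rw [compl_compl, measure_toMeasurable, h2]⟩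
    rw [Measure.map_apply hml hN.compl, Measure.restrict_apply (hml hN.compl)]
    refine withDensity_absolutelyContinuous _ _ ?_
    refine measure_mono_null (fun x hx => ?_) (lag_lipschitz ν).ae_differentiableAt_real
    exact fun hd : DifferentiableAt ℝ (lag ν) x => hx.1
      (subset_toMeasurable _ _ (mem_image_of_mem _ ⟨hx.2, hd⟩))
  have hadd : (m.restrict S).map (lag ν) + (m.restrict Sᶜ).map (lag ν) = ν := by
    rw [← Measure.map_add _ _ hml, Measure.restrict_add_restrict_compl hS, hm, map_lag_dens]
  rw [h1]
  refine Measure.eq_singularPart (Measure.measurable_rnDeriv ((m.restrict Sᶜ).map (lag ν)) volume)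
    hsing ?_
  rw [Measure.withDensity_rnDeriv_eq _ _ hac, hadd]

theorem prim_densSing (x : ℝ) : prim (densSing ν) (x + cumul ν x) = cumul (singPart ν) x := by
  have h := map_lag_apply_Iio ν (integrable_densSing ν) (densSing_nonneg ν) x
  rw [map_lag_densSing, ← ofReal_cumul,
    ENNReal.ofReal_eq_ofReal_iff (cumul_nonneg _ _)
      (prim_nonneg (densSing_nonneg ν) _)] at h
  exact h.symm

end Cumul

/-! ### The map `L` for data with equal measures -/

/-- The density dμ/dν is 1 ν-a.e.; as ν is the image of H_ξ dξ, it is 1 along y wherever H_ξ > 0,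
and elsewhere its value is irrelevant. -/
theorem toLagr_V {d : EulerData} [IsFiniteMeasure d.nu] (h : d.mu = d.nu) :
    d.toLagr.V = lagH d.nu := by
  rw [← prim_dens]
  ext ξ
  have h1 : ∀ᵐ x ∂d.nu, d.mu.rnDeriv d.nu x = 1 := by
    rw [h]; exact Measure.rnDeriv_self _
  have hml : Measurable (lag d.nu) := (lag_lipschitz d.nu).continuous.measurable
  have h2 := ae_of_ae_map (f := lag d.nu) (p := fun x => d.mu.rnDeriv d.nu x = 1)
    (μ := volume.withDensity fun η => ENNReal.ofReal (dens d.nu η)) hml.aemeasurable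
    (by rwa [map_lag_dens])
  rw [ae_withDensity_iff (measurable_dens d.nu).ennreal_ofReal] at h2
  refine integral_congr_ae (ae_restrict_of_ae ?_)
  filter_upwards [h2] with η hη
  change ((d.mu.rnDeriv d.nu (lag d.nu η)).toReal * dens d.nu η) = dens d.nu η
  by_cases h0 : dens d.nu η = 0
  · rw [h0, mul_zero]
  · rw [hη, ENNReal.toReal_one, one_mul]
    simpa using lt_of_le_of_ne (dens_nonneg d.nu η) (Ne.symm h0)

/-! ### Measures given by a cumulative function -/

/-- `F` is the left-continuous cumulative function of a finite measure. -/
structure IsCumul (F : ℝ → ℝ) : Prop where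
  mono : Monotone F
  left : ∀ x, ContinuousWithinAt F (Iio x) x
  bot : Tendsto F atBot (𝓝 0)
  bdd : ∃ M, ∀ x, F x ≤ M

namespace IsCumul

variable {F G : ℝ → ℝ}

theorem nonneg (hF : IsCumul F) (x : ℝ) : 0 ≤ F x := hF.mono.le_of_tendsto hF.bot x

theorem ofCumul_Iio (hF : IsCumul F) (x : ℝ) : ofCumul F (Iio x) = ENNReal.ofReal (F x) :=
  HunterSaxton.ofCumul_Iio F hF.mono hF.left hF.bot x

theorem isFiniteMeasure (hF : IsCumul F) : IsFiniteMeasure (ofCumul F) := by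
  obtain ⟨M, hM⟩ := hF.bdd
  have h1 : ⋃ n : ℕ, Iio (n : ℝ) = univ := by
    ext x
    simpa using exists_nat_gt x
  have h2 := tendsto_measure_iUnion_atTop (μ := ofCumul F) (s := fun n : ℕ => Iio (n : ℝ))
    fun a b hab => Iio_subset_Iio (Nat.cast_le.2 hab)
  rw [h1] at h2
  refine ⟨lt_of_le_of_lt (le_of_tendsto' h2 fun n => ?_) (ENNReal.ofReal_lt_top (r := M))⟩
  rw [Function.comp_apply, hF.ofCumul_Iio]
  exact ENNReal.ofReal_le_ofReal (hM _)

theorem cumul_ofCumul (hF : IsCumul F) : cumul (ofCumul F) = F := by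
  ext x
  rw [cumul, measureReal_def, hF.ofCumul_Iio, ENNReal.toReal_ofReal (hF.nonneg x)]

theorem add (hF : IsCumul F) (hG : IsCumul G) : IsCumul fun x => F x + G x where
  mono := hF.mono.add hG.mono
  left x := (hF.left x).add (hG.left x)
  bot := by simpa using hF.bot.add hG.bot
  bdd := by
    obtain ⟨M, hM⟩ := hF.bdd
    obtain ⟨N, hN⟩ := hG.bdd
    exact ⟨M + N, fun x => add_le_add (hM x) (hN x)⟩

theorem ofCumul_add (hF : IsCumul F) (hG : IsCumul G) :
    ofCumul (fun x => F x + G x) = ofCumul F + ofCumul G := by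
  have := hF.isFiniteMeasure
  have := hG.isFiniteMeasure
  have := (hF.add hG).isFiniteMeasure
  refine Measure.ext_of_Iio fun x => ?_
  rw [Measure.add_apply, (hF.add hG).ofCumul_Iio, hF.ofCumul_Iio, hG.ofCumul_Iio,
    ENNReal.ofReal_add (hF.nonneg x) (hG.nonneg x)]

theorem ofCumul_Ico (hF : IsCumul F) {a b : ℝ} (hab : a ≤ b) :
    ofCumul F (Ico a b) = ENNReal.ofReal (F b - F a) := by
  have := hF.isFiniteMeasure
  have h1 : Ico a b = Iio b \ Iio a := by ext x; simp
  rw [h1, measure_sdiff (Iio_subset_Iio hab) nullMeasurableSet_Iio (measure_ne_top _ _),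
    hF.ofCumul_Iio, hF.ofCumul_Iio, ENNReal.ofReal_sub _ (hF.nonneg a)]

theorem ofCumul_restrict_of_affine (hF : IsCumul F) {a b c : ℝ}
    (h : ∀ x ∈ Icc a b, F x - F a = c * (x - a)) :
    (ofCumul F).restrict (Ico a b) = ENNReal.ofReal c • volume.restrict (Ico a b) := by
  have := hF.isFiniteMeasure
  have := (volume.restrict (Ico a b)).smul_finite (ENNReal.ofReal_ne_top (r := c))
  refine Measure.ext_of_Iio fun x => ?_
  have h1 : Iio x ∩ Ico a b = Ico a (min x b) := by ext y; simp; tauto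
  rw [Measure.smul_apply, Measure.restrict_apply measurableSet_Iio,
    Measure.restrict_apply measurableSet_Iio, h1]
  rcases le_or_gt a (min x b) with hx | hx
  · rw [hF.ofCumul_Ico hx, h _ ⟨hx, min_le_right _ _⟩, Real.volume_Ico, smul_eq_mul,
      ENNReal.ofReal_mul' (by linarith)]
  · rw [Ico_eq_empty (not_lt.2 hx.le)]
    simp

end IsCumul

theorem singPart_add_eq {μ ν : Measure ℝ} [IsFiniteMeasure μ] (hμ : μ ≪ volume)
    (hν : ν ⟂ₘ volume) : singPart (μ + ν) = ν := by
  refine (Measure.eq_singularPart (Measure.measurable_rnDeriv μ volume) hν ?_).symm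
  rw [Measure.withDensity_rnDeriv_eq _ _ hμ, add_comm]

/-! ### The projected cumulative energy -/

namespace EulerData

variable {d : EulerData} {Δx : ℝ} {σ : ℤ → ℤˣ}

theorem cell_eq_iff (hΔx : 0 < Δx) {x : ℝ} {j : ℤ} :
    cell Δx x = j ↔ 2 * j * Δx < x ∧ x ≤ (2 * j + 2) * Δx := by
  rw [cell, sub_eq_iff_eq_add, Int.ceil_eq_iff, lt_div_iff₀ (by positivity),
    div_le_iff₀ (by positivity)]
  push_cast
  rw [show ((j : ℝ) + 1 - 1) * (2 * Δx) = 2 * j * Δx by ring,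
    show ((j : ℝ) + 1) * (2 * Δx) = (2 * j + 2) * Δx by ring]

theorem lt_of_cell (hΔx : 0 < Δx) (x : ℝ) : 2 * cell Δx x * Δx < x := ((cell_eq_iff hΔx).1 rfl).1

theorem le_of_cell (hΔx : 0 < Δx) (x : ℝ) : x ≤ (2 * cell Δx x + 2) * Δx :=
  ((cell_eq_iff hΔx).1 rfl).2

theorem cell_mono (hΔx : 0 < Δx) : Monotone (cell Δx) := fun x y h =>
  sub_le_sub_right (Int.ceil_mono (div_le_div_of_nonneg_right h (by positivity))) 1

theorem grid_mono (hΔx : 0 < Δx) {i j : ℤ} (h : i + 1 ≤ j) : (2 * (i : ℝ) + 2) * Δx ≤ 2 * j * Δx := by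
  have : (i : ℝ) + 1 ≤ j := by exact_mod_cast h
  nlinarith

theorem signOf_sq (j : ℤ) : signOf σ j ^ 2 = 1 := by
  rcases Int.units_eq_one_or (σ j) with h | h <;> simp [signOf, h]

variable (d Δx σ) in
/-- The slope of `F_{Δx,ac}` in the left half of a cell. -/
noncomputable def slopeL (j : ℤ) : ℝ := (d.diffU Δx j - signOf σ j * d.q Δx j) ^ 2

variable (d Δx σ) in
/-- The slope of `F_{Δx,ac}` in the right half of a cell. -/
noncomputable def slopeR (j : ℤ) : ℝ := (d.diffU Δx j + signOf σ j * d.q Δx j) ^ 2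

theorem slopeL_nonneg (j : ℤ) : 0 ≤ d.slopeL Δx σ j := sq_nonneg _

theorem slopeR_nonneg (j : ℤ) : 0 ≤ d.slopeR Δx σ j := sq_nonneg _

/-- This is what q is chosen for: (Du - σq)² + (Du + σq)² = 2(Du)² + 2q² = 2DF_ac, provided the
radicand is nonnegative. -/
theorem slopes_add (hΔx : 0 < Δx) {j : ℤ} (hq : (d.diffU Δx j) ^ 2 ≤ d.diffFac Δx j) :
    (d.slopeL Δx σ j + d.slopeR Δx σ j) * Δx =
      cumul (acPart d.mu) ((2 * j + 2) * Δx) - cumul (acPart d.mu) (2 * j * Δx) := by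
  have h1 : d.q Δx j ^ 2 = d.diffFac Δx j - (d.diffU Δx j) ^ 2 := Real.sq_sqrt (by linarith)
  have h2 := signOf_sq (σ := σ) j
  have h3 : d.diffFac Δx j * (2 * Δx) =
      cumul (acPart d.mu) ((2 * j + 2) * Δx) - cumul (acPart d.mu) (2 * j * Δx) := by
    rw [diffFac]; field_simp
  rw [← h3, slopeL, slopeR]
  linear_combination 2 * Δx * h1 + 2 * d.q Δx j ^ 2 * Δx * h2

theorem slopes_sub (j : ℤ) :
    d.slopeR Δx σ j - d.slopeL Δx σ j = 4 * (signOf σ j * (d.diffU Δx j * d.q Δx j)) := by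
  rw [slopeL, slopeR]; ring

theorem projFac_right (hΔx : 0 < Δx) {j : ℤ} (hq : (d.diffU Δx j) ^ 2 ≤ d.diffFac Δx j) {x : ℝ}
    (h1 : (2 * j + 1) * Δx ≤ x) (h2 : x ≤ (2 * j + 2) * Δx) :
    d.projFac Δx σ x =
      cumul (acPart d.mu) ((2 * j + 2) * Δx) - d.slopeR Δx σ j * ((2 * j + 2) * Δx - x) := by
  have hc : cell Δx x = j := (cell_eq_iff hΔx).2 ⟨by nlinarith, h2⟩
  have hs := slopes_add (σ := σ) hΔx hq
  have hd := slopes_sub (d := d) (Δx := Δx) (σ := σ) j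
  rw [projFac, hc]
  rcases h1.eq_or_lt with h1 | h1
  -- The midpoint falls in the left branch of the definition; equality there is continuity at the
  -- midpoint.
  · rw [if_pos h1.ge, ← slopeL, ← h1]
    linear_combination hs
  · rw [if_neg (not_le.2 h1), ← slopeR]
    linear_combination (1 / 2) * hs + Δx / 2 * hd

theorem projFac_grid (hΔx : 0 < Δx) (hq : ∀ j, (d.diffU Δx j) ^ 2 ≤ d.diffFac Δx j) (j : ℤ) :
    d.projFac Δx σ (2 * j * Δx) = cumul (acPart d.mu) (2 * j * Δx) := by
  have h : (2 * ((j - 1 : ℤ) : ℝ) + 2) * Δx = 2 * j * Δx := by push_cast; ring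
  have h2 := projFac_right (σ := σ) hΔx (hq (j - 1)) (x := 2 * j * Δx)
    (by push_cast; nlinarith) h.ge
  rw [h] at h2
  rw [h2]; ring

theorem projFac_left (hΔx : 0 < Δx) (hq : ∀ j, (d.diffU Δx j) ^ 2 ≤ d.diffFac Δx j) {j : ℤ} {x : ℝ}
    (h1 : 2 * j * Δx ≤ x) (h2 : x ≤ (2 * j + 1) * Δx) :
    d.projFac Δx σ x =
      cumul (acPart d.mu) (2 * j * Δx) + d.slopeL Δx σ j * (x - 2 * j * Δx) := by
  rcases h1.eq_or_lt with h1 | h1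
  · rw [← h1, projFac_grid hΔx hq]; ring
  have hc : cell Δx x = j := (cell_eq_iff hΔx).2 ⟨h1, by nlinarith⟩
  rw [projFac, hc]
  rw [if_pos h2, ← slopeL]

theorem projFac_sub_of_mem_cell (hΔx : 0 < Δx) (hq : ∀ j, (d.diffU Δx j) ^ 2 ≤ d.diffFac Δx j)
    {j : ℤ} {x y : ℝ} (h1 : 2 * j * Δx ≤ x) (h2 : x ≤ y) (h3 : y ≤ (2 * j + 2) * Δx) :
    d.projFac Δx σ x ≤ d.projFac Δx σ y ∧ d.projFac Δx σ y - d.projFac Δx σ x ≤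
      (d.slopeL Δx σ j + d.slopeR Δx σ j) * (y - x) := by
  have hP := slopeL_nonneg (d := d) (Δx := Δx) (σ := σ) j
  have hQ := slopeR_nonneg (d := d) (Δx := Δx) (σ := σ) j
  have hs := slopes_add (σ := σ) hΔx (hq j)
  rcases le_total y ((2 * j + 1) * Δx) with hy | hy
  · rw [projFac_left hΔx hq (h1.trans h2) hy, projFac_left hΔx hq h1 (h2.trans hy)]
    constructor <;> nlinarith
  rcases le_total x ((2 * j + 1) * Δx) with hx | hx
  · rw [projFac_right hΔx (hq j) hy h3, projFac_left hΔx hq h1 hx]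
    constructor <;> nlinarith
  · rw [projFac_right hΔx (hq j) hy h3, projFac_right hΔx (hq j) hx (h2.trans h3)]
    constructor <;> nlinarith

theorem projFac_grid_succ (hΔx : 0 < Δx) (hq : ∀ j, (d.diffU Δx j) ^ 2 ≤ d.diffFac Δx j) (j : ℤ) :
    d.projFac Δx σ ((2 * j + 2) * Δx) = cumul (acPart d.mu) ((2 * j + 2) * Δx) := by
  have := projFac_grid (σ := σ) hΔx hq (j + 1)
  push_cast at this
  rwa [mul_add, mul_one] at this

theorem tendsto_atBot_of_le_cumul {G : ℝ → ℝ} (μ : Measure ℝ) [IsFiniteMeasure μ] {c : ℝ}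
    (h0 : ∀ x, 0 ≤ G x) (h : ∀ x, G x ≤ cumul μ (x + c)) : Tendsto G atBot (𝓝 0) :=
  squeeze_zero h0 h ((cumul_tendsto_atBot μ).comp (tendsto_atBot_add_const_right _ c tendsto_id))

theorem isCumul_projFac [IsFiniteMeasure d.mu] (hΔx : 0 < Δx)
    (hq : ∀ j, (d.diffU Δx j) ^ 2 ≤ d.diffFac Δx j) : IsCumul (d.projFac Δx σ) := by
  have hlow (x : ℝ) : cumul (acPart d.mu) (2 * cell Δx x * Δx) ≤ d.projFac Δx σ x := by
    rw [← projFac_grid (σ := σ) hΔx hq]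
    exact (projFac_sub_of_mem_cell hΔx hq le_rfl (lt_of_cell hΔx x).le (le_of_cell hΔx x)).1
  have hup (x : ℝ) : d.projFac Δx σ x ≤ cumul (acPart d.mu) ((2 * cell Δx x + 2) * Δx) := by
    rw [← projFac_grid_succ (σ := σ) hΔx hq]
    exact (projFac_sub_of_mem_cell hΔx hq (lt_of_cell hΔx x).le (le_of_cell hΔx x) le_rfl).1
  refine ⟨fun x y hxy => ?_, fun x => ?_, ?_, (acPart d.mu).real univ,
    fun x => (hup x).trans (cumul_le _ _)⟩
  · rcases (cell_mono hΔx hxy).eq_or_lt with h | h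
    · refine (projFac_sub_of_mem_cell hΔx hq (lt_of_cell hΔx x).le hxy ?_).1
      rw [h]
      exact le_of_cell hΔx y
    · exact (hup x).trans ((cumul_mono _ (grid_mono hΔx h)).trans (hlow y))
  · set j := cell Δx x with hj
    have h1 : Tendsto (fun y => d.projFac Δx σ x
        - (d.slopeL Δx σ j + d.slopeR Δx σ j) * (x - y)) (𝓝[<] x) (𝓝 (d.projFac Δx σ x)) := by
      have : Continuous fun y => d.projFac Δx σ x
        - (d.slopeL Δx σ j + d.slopeR Δx σ j) * (x - y) := by fun_prop
      simpa using (this.tendsto x).mono_left nhdsWithin_le_nhds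
    refine tendsto_of_tendsto_of_tendsto_of_le_of_le' h1 tendsto_const_nhds ?_ ?_
    all_goals
      filter_upwards [Ioo_mem_nhdsLT (lt_of_cell hΔx x)] with y hy
      have := projFac_sub_of_mem_cell (σ := σ) hΔx hq hy.1.le hy.2.le (le_of_cell hΔx x)
      linarith
  · refine tendsto_atBot_of_le_cumul (acPart d.mu) (c := 2 * Δx)
      (fun x => (cumul_nonneg _ _).trans (hlow x)) fun x => (hup x).trans (cumul_mono _ ?_)
    linarith [lt_of_cell hΔx x]

/-! ### The projected singular energy and the Lebesgue decomposition of the projected measure -/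

theorem projFsing_of_mem (hΔx : 0 < Δx) {j : ℤ} {x : ℝ} (h1 : 2 * j * Δx < x)
    (h2 : x ≤ (2 * j + 2) * Δx) :
    d.projFsing Δx x = cumul (singPart d.mu) ((2 * j + 2) * Δx) := by
  rw [projFsing, (cell_eq_iff hΔx).2 ⟨h1, h2⟩]

theorem projFsing_grid (hΔx : 0 < Δx) (j : ℤ) :
    d.projFsing Δx (2 * j * Δx) = cumul (singPart d.mu) (2 * j * Δx) := by
  have h : (2 * ((j - 1 : ℤ) : ℝ) + 2) * Δx = 2 * j * Δx := by push_cast; ring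
  rw [projFsing_of_mem hΔx (j := j - 1) (by push_cast; nlinarith) h.ge, h]

theorem isCumul_projFsing [IsFiniteMeasure d.mu] (hΔx : 0 < Δx) : IsCumul (d.projFsing Δx) := by
  refine ⟨fun x y hxy => cumul_mono _ ?_, fun x => ?_, ?_, (singPart d.mu).real univ,
    fun x => cumul_le _ _⟩
  · have h : (cell Δx x : ℝ) ≤ cell Δx y := by exact_mod_cast cell_mono hΔx hxy
    nlinarith
  · refine tendsto_const_nhds.congr' ?_
    filter_upwards [Ioo_mem_nhdsLT (lt_of_cell hΔx x)] with y hy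
    rw [projFsing_of_mem hΔx hy.1 (hy.2.le.trans (le_of_cell hΔx x)), projFsing]
  · refine tendsto_atBot_of_le_cumul (singPart d.mu) (c := 2 * Δx)
      (fun x => cumul_nonneg _ _) fun x => cumul_mono _ ?_
    linarith [lt_of_cell hΔx x]

theorem ofCumul_projFac_absolutelyContinuous [IsFiniteMeasure d.mu] (hΔx : 0 < Δx)
    (hq : ∀ j, (d.diffU Δx j) ^ 2 ≤ d.diffFac Δx j) : ofCumul (d.projFac Δx σ) ≪ volume := by
  have hF := isCumul_projFac (σ := σ) hΔx hq
  have key {a b c : ℝ}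
      (h : ∀ x ∈ Icc a b, d.projFac Δx σ x - d.projFac Δx σ a = c * (x - a)) {N : Set ℝ}
      (hN : volume N = 0) : ofCumul (d.projFac Δx σ) (N ∩ Ico a b) = 0 := by
    rw [← Measure.restrict_apply' measurableSet_Ico, hF.ofCumul_restrict_of_affine h,
      Measure.smul_apply, Measure.restrict_apply' measurableSet_Ico,
      measure_mono_null inter_subset_left hN, smul_zero]
  intro N hN
  -- The half cells are closed on the left here, unlike in `cell`, because a left-continuous F
  -- measures [a, b) by F(b) - F(a).
  have hcover : N ⊆ ⋃ j : ℤ, (N ∩ Ico (2 * j * Δx) ((2 * j + 1) * Δx)) ∪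
      (N ∩ Ico ((2 * j + 1) * Δx) ((2 * j + 2) * Δx)) := by
    intro x hx
    have h1 : (⌊x / (2 * Δx)⌋ : ℝ) * (2 * Δx) ≤ x :=
      (le_div_iff₀ (by positivity)).1 (Int.floor_le _)
    have h2 : x < ((⌊x / (2 * Δx)⌋ : ℝ) + 1) * (2 * Δx) :=
      (div_lt_iff₀ (by positivity)).1 (Int.lt_floor_add_one _)
    refine mem_iUnion.2 ⟨⌊x / (2 * Δx)⌋, ?_⟩
    rcases lt_or_ge x ((2 * ⌊x / (2 * Δx)⌋ + 1) * Δx) with h | h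
    · exact Or.inl ⟨hx, by linarith, h⟩
    · exact Or.inr ⟨hx, h, by linarith⟩
  refine measure_mono_null hcover (measure_iUnion_null fun j => measure_union_null ?_ ?_)
  · refine key (c := d.slopeL Δx σ j) (fun x hx => ?_) hN
    rw [projFac_left hΔx hq hx.1 hx.2, projFac_grid hΔx hq]
    ring
  · refine key (c := d.slopeR Δx σ j) (fun x hx => ?_) hN
    rw [projFac_right hΔx (hq j) hx.1 hx.2, projFac_right hΔx (hq j) le_rfl (by nlinarith)]
    ring

/-- The staircase jumps only at the countably many grid points, so off the grid every point has a
neighbourhood of measure zero. -/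
theorem ofCumul_projFsing_mutuallySingular [IsFiniteMeasure d.mu] (hΔx : 0 < Δx) :
    ofCumul (d.projFsing Δx) ⟂ₘ volume := by
  have hF := isCumul_projFsing (d := d) hΔx
  set G : Set ℝ := range fun j : ℤ => (2 * (j : ℝ) + 2) * Δx with hG
  have hGc : G.Countable := countable_range _
  refine ⟨Gᶜ, hGc.measurableSet.compl, ?_, by rw [compl_compl]; exact hGc.measure_zero _⟩
  refine measure_null_of_locally_null _ fun x hx => ?_
  have h1 := lt_of_cell hΔx x
  have h2 := lt_of_le_of_ne (le_of_cell hΔx x) fun h => hx ⟨cell Δx x, h.symm⟩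
  -- The left end is strictly inside the cell and the right end is an excluded grid point, where
  -- left continuity still gives the value of the cell.
  refine ⟨Ico ((2 * cell Δx x * Δx + x) / 2) ((2 * cell Δx x + 2) * Δx),
    mem_nhdsWithin_of_mem_nhds (Ico_mem_nhds (by linarith) h2), ?_⟩
  rw [hF.ofCumul_Ico (by linarith), projFsing_of_mem hΔx (by nlinarith) le_rfl,
    projFsing_of_mem hΔx (j := cell Δx x) (by linarith) (by linarith)]
  simp

theorem isCumul_projF [IsFiniteMeasure d.mu] (hΔx : 0 < Δx)
    (hq : ∀ j, (d.diffU Δx j) ^ 2 ≤ d.diffFac Δx j) : IsCumul (d.projF Δx σ) :=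
  (isCumul_projFac hΔx hq).add (isCumul_projFsing hΔx)

theorem singPart_proj [IsFiniteMeasure d.mu] (hΔx : 0 < Δx)
    (hq : ∀ j, (d.diffU Δx j) ^ 2 ≤ d.diffFac Δx j) :
    singPart (d.proj Δx σ).nu = ofCumul (d.projFsing Δx) := by
  have := (isCumul_projFac (σ := σ) hΔx hq).isFiniteMeasure
  change singPart (ofCumul fun x => d.projFac Δx σ x + d.projFsing Δx x) = _
  rw [(isCumul_projFac hΔx hq).ofCumul_add (isCumul_projFsing hΔx)]
  exact singPart_add_eq (ofCumul_projFac_absolutelyContinuous hΔx hq)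
    (ofCumul_projFsing_mutuallySingular hΔx)

theorem cumul_singPart_proj_grid [IsFiniteMeasure d.mu] (hΔx : 0 < Δx)
    (hq : ∀ j, (d.diffU Δx j) ^ 2 ≤ d.diffFac Δx j) (j : ℤ) :
    cumul (singPart (d.proj Δx σ).nu) (2 * j * Δx) = cumul (singPart d.mu) (2 * j * Δx) := by
  rw [singPart_proj hΔx hq, (isCumul_projFsing hΔx).cumul_ofCumul, projFsing_grid hΔx]

theorem cumul_proj_grid [IsFiniteMeasure d.mu] (hΔx : 0 < Δx)
    (hq : ∀ j, (d.diffU Δx j) ^ 2 ≤ d.diffFac Δx j) (j : ℤ) :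
    cumul (d.proj Δx σ).nu (2 * j * Δx) = cumul d.mu (2 * j * Δx) := by
  change cumul (ofCumul (d.projF Δx σ)) _ = _
  rw [(isCumul_projF hΔx hq).cumul_ofCumul, projF, projFac_grid hΔx hq, projFsing_grid hΔx,
    cumul_acPart_add_singPart]

end EulerData

/-! ### Estimates for the Eulerian energy -/

theorem ContDiff.absolutelyContinuousOnInterval {f : ℝ → ℝ} (hf : ContDiff ℝ (⊤ : ℕ∞) f) (a b : ℝ) :
    AbsolutelyContinuousOnInterval f a b := by
  obtain ⟨K, hK⟩ := (hf.of_le (m := 1) (by exact_mod_cast le_top)).contDiffOn.exists_lipschitzOnWith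
    (s := uIcc a b) one_ne_zero (convex_uIcc a b) isCompact_uIcc
  exact hK.absolutelyContinuousOnInterval

theorem MemE2.absolutelyContinuousOnInterval {f : ℝ → ℝ} (hf : MemE2 f) (a b : ℝ) :
    AbsolutelyContinuousOnInterval f a b := by
  obtain ⟨p, m, f₀, c, e, hpm, hf₀, h⟩ := hf
  have h1 := ((hf₀.2.1 a b).add
    ((ContDiff.absolutelyContinuousOnInterval hpm.smooth_p a b).const_mul c)).add
    ((ContDiff.absolutelyContinuousOnInterval hpm.smooth_m a b).const_mul e)
  rw [show f = fun x => f₀ x + c * p x + e * m x from funext h]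
  exact h1

/-- Cauchy–Schwarz, obtained from the nonnegative variance of g about its mean c. -/
theorem sq_integral_le {g : ℝ → ℝ} {a b : ℝ} (hab : a ≤ b) (hg : IntervalIntegrable g volume a b)
    (hg2 : IntervalIntegrable (fun x => g x ^ 2) volume a b) :
    (∫ x in a..b, g x) ^ 2 ≤ (b - a) * ∫ x in a..b, g x ^ 2 := by
  rcases hab.eq_or_lt with rfl | hab'
  · simp
  set I := ∫ x in a..b, g x with hI
  set c := I / (b - a) with hc
  have h0 : 0 ≤ ∫ x in a..b, (g x - c) ^ 2 :=
    intervalIntegral.integral_nonneg hab fun x _ => sq_nonneg _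
  have h1 : ∫ x in a..b, (g x - c) ^ 2 = (∫ x in a..b, g x ^ 2) - 2 * c * I + c ^ 2 * (b - a) := by
    have h2 : ∀ x, (g x - c) ^ 2 = g x ^ 2 - (2 * c) * g x + c ^ 2 := fun x => by ring
    simp only [h2]
    rw [intervalIntegral.integral_add (hg2.sub (hg.const_mul _)) intervalIntegrable_const,
      intervalIntegral.integral_sub hg2 (hg.const_mul _), intervalIntegral.integral_const_mul,
      intervalIntegral.integral_const, smul_eq_mul]
    ring
  have hI' : I = c * (b - a) := by rw [hc]; field_simp
  rw [h1] at h0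
  have h3 : 0 < b - a := sub_pos.2 hab'
  have h4 : 0 ≤ (b - a) * ((∫ x in a..b, g x ^ 2) - 2 * c * I + c ^ 2 * (b - a)) :=
    mul_nonneg h3.le h0
  rw [hI'] at h4 ⊢
  nlinarith

namespace EulerData

variable {d : EulerData}

theorem integrable_deriv_sq [IsFiniteMeasure d.mu]
    (h : acPart d.mu = volume.withDensity fun x => ENNReal.ofReal (deriv d.u x ^ 2)) :
    Integrable (fun x => deriv d.u x ^ 2) volume := by
  have hm : Measurable fun x => deriv d.u x ^ 2 := (measurable_deriv d.u).pow_const 2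
  refine ⟨hm.aestronglyMeasurable, ?_⟩
  rw [hasFiniteIntegral_iff_ofReal (Eventually.of_forall fun x => sq_nonneg _)]
  have h1 : acPart d.mu univ < ∞ := measure_lt_top _ _
  rwa [h, withDensity_apply _ MeasurableSet.univ, setLIntegral_univ] at h1

theorem cumul_acPart_sub [IsFiniteMeasure d.mu]
    (h : acPart d.mu = volume.withDensity fun x => ENNReal.ofReal (deriv d.u x ^ 2)) (a b : ℝ) :
    cumul (acPart d.mu) b - cumul (acPart d.mu) a = ∫ x in a..b, deriv d.u x ^ 2 := by
  have hi := integrable_deriv_sq h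
  rw [← prim_sub hi]
  have key (c : ℝ) : cumul (acPart d.mu) c = prim (fun x => deriv d.u x ^ 2) c := by
    rw [cumul, measureReal_def, h, withDensity_apply _ measurableSet_Iio, prim,
      integral_Iic_eq_integral_Iio, integral_eq_lintegral_of_nonneg_ae
        (Eventually.of_forall fun x => sq_nonneg _) hi.aestronglyMeasurable.restrict]
  rw [key, key]

/-- Cauchy–Schwarz for u_x on one cell; hence the square root defining q is never truncated to 0. -/
theorem diffU_sq_le [IsFiniteMeasure d.mu] (hu : MemE2 d.u)
    (h : acPart d.mu = volume.withDensity fun x => ENNReal.ofReal (deriv d.u x ^ 2)) {Δx : ℝ}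
    (hΔx : 0 < Δx) (j : ℤ) : (d.diffU Δx j) ^ 2 ≤ d.diffFac Δx j := by
  have hac := hu.absolutelyContinuousOnInterval (2 * j * Δx) ((2 * j + 2) * Δx)
  have h1 := sq_integral_le (by nlinarith) hac.intervalIntegrable_deriv
    (integrable_deriv_sq h).intervalIntegrable
  rw [hac.integral_deriv_eq_sub, ← cumul_acPart_sub h,
    show (2 * (j : ℝ) + 2) * Δx - 2 * j * Δx = 2 * Δx by ring] at h1
  rw [diffU, diffFac, div_pow, div_le_div_iff₀ (by positivity) (by positivity)]
  nlinarith

/-- The integral over [x, x + c] is the difference of the tails from x and x + c, that is, minus the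
integral of f(· + c) - f over (x, ∞). -/
theorem ofReal_integral_le_eLpNorm_shift {f : ℝ → ℝ} (hf : Integrable f volume) {x c : ℝ}
    (hc : 0 ≤ c) :
    ENNReal.ofReal (∫ z in x..(x + c), f z) ≤ eLpNorm (fun z => f (z + c) - f z) 1 volume := by
  have hf' : Integrable (fun z => f (z + c)) volume := hf.comp_add_right c
  have h1 : ∫ z in Ioi x, f (z + c) = ∫ z in Ioi (x + c), f z := by
    have h := (measurePreserving_add_right volume c).setIntegral_preimage_emb
      (measurableEmbedding_addRight c) f (Ioi (x + c))
    simpa using! h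
  have h2 : ∫ z in x..(x + c), f z = -∫ z in Ioi x, (f (z + c) - f z) := by
    rw [integral_sub hf'.integrableOn hf.integrableOn, h1,
      intervalIntegral.integral_of_le (by linarith), ← Ioc_union_Ioi_eq_Ioi (show x ≤ x + c by linarith),
      setIntegral_union Ioc_disjoint_Ioi_same measurableSet_Ioi hf.integrableOn hf.integrableOn]
    ring
  rw [h2, eLpNorm_one_eq_lintegral_enorm]
  refine (ENNReal.ofReal_le_ofReal (neg_le_abs _)).trans ?_
  rw [← Real.enorm_eq_ofReal_abs]
  exact (enorm_integral_le_lintegral_enorm _).trans (setLIntegral_le_lintegral _ _)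

end EulerData

/-! ### The change of variables -/

section ChangeOfVariables

variable {μ ν : Measure ℝ} [IsFiniteMeasure μ] [IsFiniteMeasure ν]

/-- The map ξ ↦ y₁(ξ) - y₂(2r - ξ) is continuous and nondecreasing, negative far left and
nonnegative far right up to bounded offsets, so φ(r) is its first zero. The equivalence replaces the
supremum from here on. -/
theorem exists_crossing (μ ν : Measure ℝ) [IsFiniteMeasure μ] [IsFiniteMeasure ν] (r : ℝ) :
    lag μ (phi (lag μ) (lag ν) r) = lag ν (psi (lag μ) (lag ν) r) ∧
      ∀ ξ, lag ν (2 * r - ξ) ≤ lag μ ξ ↔ phi (lag μ) (lag ν) r ≤ ξ := by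
  set S := {ξ : ℝ | ∀ ξ' < ξ, lag μ ξ' < lag ν (2 * r - ξ')} with hS
  have hmono {ξ ξ' : ℝ} (h : ξ ≤ ξ') (h2 : lag ν (2 * r - ξ) ≤ lag μ ξ) :
      lag ν (2 * r - ξ') ≤ lag μ ξ' :=
    ((lag_mono ν (by linarith)).trans h2).trans (lag_mono μ h)
  have hb : BddAbove S := by
    refine ⟨r + μ.real univ, fun ξ hξ => ?_⟩
    by_contra! h
    have h1 := hξ _ h
    have h2 := sub_le_lag μ (r + μ.real univ)
    have h3 := lag_le_self ν (2 * r - (r + μ.real univ))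
    linarith [measureReal_nonneg (μ := μ) (s := univ)]
  have hne : S.Nonempty := by
    refine ⟨r - ν.real univ, fun ξ hξ => ?_⟩
    have h2 := sub_le_lag ν (2 * r - ξ)
    have h3 := lag_le_self μ ξ
    linarith [measureReal_nonneg (μ := ν) (s := univ)]
  have hphi : phi (lag μ) (lag ν) r = sSup S := rfl
  have hlt {ξ : ℝ} (h : ξ < sSup S) : lag μ ξ < lag ν (2 * r - ξ) := by
    obtain ⟨z, hz, hz2⟩ := exists_lt_of_lt_csSup hne h
    exact hz ξ hz2
  have hge {ξ : ℝ} (h : sSup S < ξ) : lag ν (2 * r - ξ) ≤ lag μ ξ := by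
    by_contra! h2
    refine absurd (le_csSup hb (show ξ ∈ S from fun ξ' hξ' => ?_)) (not_le.2 h)
    by_contra! h3
    exact absurd (hmono hξ'.le h3) (not_le.2 h2)
  have hcμ : Continuous (lag μ) := (lag_lipschitz μ).continuous
  have hcν : Continuous fun ξ => lag ν (2 * r - ξ) :=
    (lag_lipschitz ν).continuous.comp (continuous_const.sub continuous_id)
  have h1 : lag μ (sSup S) ≤ lag ν (2 * r - sSup S) :=
    le_of_tendsto_of_tendsto ((hcμ.tendsto _).mono_left nhdsWithin_le_nhds)
      ((hcν.tendsto _).mono_left nhdsWithin_le_nhds)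
      (eventually_mem_nhdsWithin.mono fun _ h => (hlt (mem_Iio.1 h)).le : _ ≤ᶠ[𝓝[<] sSup S] _)
  have h2 : lag ν (2 * r - sSup S) ≤ lag μ (sSup S) :=
    le_of_tendsto_of_tendsto ((hcν.tendsto _).mono_left nhdsWithin_le_nhds)
      ((hcμ.tendsto _).mono_left nhdsWithin_le_nhds)
      (eventually_mem_nhdsWithin.mono fun _ h => hge (mem_Ioi.1 h) : _ ≤ᶠ[𝓝[>] sSup S] _)
  refine ⟨le_antisymm h1 h2, fun ξ => ⟨fun h => ?_, fun h => hmono h h2⟩⟩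
  rw [hphi]
  by_contra! h3
  exact absurd (hlt h3) (not_lt.2 h)

theorem lag_phi (r : ℝ) : lag μ (phi (lag μ) (lag ν) r) = lag ν (psi (lag μ) (lag ν) r) :=
  (exists_crossing μ ν r).1

theorem phi_le_iff {r ξ : ℝ} :
    phi (lag μ) (lag ν) r ≤ ξ ↔ lag ν (2 * r - ξ) ≤ lag μ ξ :=
  ((exists_crossing μ ν r).2 ξ).symm

theorem phi_mono : Monotone (phi (lag μ) (lag ν)) := fun r r' h =>
  phi_le_iff.2 ((lag_mono ν (by linarith)).trans (phi_le_iff.1 le_rfl))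

theorem psi_mono : Monotone (psi (lag μ) (lag ν)) := fun r r' h => by
  have h1 : phi (lag μ) (lag ν) r' ≤ phi (lag μ) (lag ν) r + 2 * (r' - r) := by
    refine phi_le_iff.2 ?_
    rw [show 2 * r' - (phi (lag μ) (lag ν) r + 2 * (r' - r)) = 2 * r - phi (lag μ) (lag ν) r by ring]
    exact (phi_le_iff.1 le_rfl).trans (lag_mono μ (by linarith))
  unfold psi
  linarith

theorem phi_lipschitz : LipschitzWith 2 (phi (lag μ) (lag ν)) :=
  lipschitz_of_monotone_of_monotone_sub phi_mono (by simpa [psi] using! psi_mono (μ := μ) (ν := ν))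

theorem psi_lipschitz : LipschitzWith 2 (psi (lag μ) (lag ν)) :=
  lipschitz_of_monotone_of_monotone_sub psi_mono (by simpa [psi] using! phi_mono (μ := μ) (ν := ν))

theorem abs_phi_sub_le (r : ℝ) :
    |phi (lag μ) (lag ν) r - r| ≤ μ.real univ + ν.real univ := by
  have h := lag_phi (μ := μ) (ν := ν) r
  have h1 := lag_le_self μ (phi (lag μ) (lag ν) r)
  have h2 := lag_le_self ν (psi (lag μ) (lag ν) r)
  have h3 := sub_le_lag μ (phi (lag μ) (lag ν) r)
  have h4 := sub_le_lag ν (psi (lag μ) (lag ν) r)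
  have h5 : psi (lag μ) (lag ν) r = 2 * r - phi (lag μ) (lag ν) r := rfl
  have h6 : 0 ≤ μ.real univ := measureReal_nonneg
  have h7 : 0 ≤ ν.real univ := measureReal_nonneg
  rw [abs_le]
  constructor <;> linarith

theorem abs_psi_sub_le (r : ℝ) :
    |psi (lag μ) (lag ν) r - r| ≤ μ.real univ + ν.real univ := by
  rw [show psi (lag μ) (lag ν) r - r = -(phi (lag μ) (lag ν) r - r) by rw [psi]; ring, abs_neg]
  exact abs_phi_sub_le r

theorem tendsto_atBot_of_abs_sub_le {f : ℝ → ℝ} {M : ℝ} (h : ∀ r, |f r - r| ≤ M) :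
    Tendsto f atBot atBot :=
  tendsto_atBot_mono (fun r => by linarith [(abs_le.1 (h r)).2] : ∀ r, f r ≤ r + M)
    (tendsto_atBot_add_const_right _ M tendsto_id)

theorem tendsto_atTop_of_abs_sub_le {f : ℝ → ℝ} {M : ℝ} (h : ∀ r, |f r - r| ≤ M) :
    Tendsto f atTop atTop :=
  tendsto_atTop_mono (fun r => by linarith [(abs_le.1 (h r)).1] : ∀ r, r + -M ≤ f r)
    (tendsto_atTop_add_const_right _ (-M) tendsto_id)

/-- At r = x + F(x) both y₁ and y₂ equal x, so r is a crossing. It is the first: y₁ < x strictly to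
the left of r, while y₂ ≥ x to its right. -/
theorem phi_add_cumul {x : ℝ} (h : cumul μ x = cumul ν x) :
    phi (lag μ) (lag ν) (x + cumul μ x) = x + cumul μ x := by
  refine le_antisymm (phi_le_iff.2 ?_) (le_of_forall_lt_imp_le_of_dense fun ξ hξ => ?_)
  · rw [lag_add_cumul, two_mul, add_sub_cancel_right, h, lag_add_cumul]
  · by_contra! h2
    have h3 := phi_le_iff.1 h2.le
    have h4 : lag μ ξ < x := (lag_lt_iff μ).2 hξ
    have h5 : x ≤ lag ν (2 * (x + cumul μ x) - ξ) := (le_lag_iff ν).2 (by linarith)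
    linarith

theorem psi_add_cumul {x : ℝ} (h : cumul μ x = cumul ν x) :
    psi (lag μ) (lag ν) (x + cumul μ x) = x + cumul μ x := by
  rw [psi, phi_add_cumul h]; ring

end ChangeOfVariables

/-! ### The Lagrangian energy at a fixed time -/

/-- `k` is the fraction of the initial energy that is retained: no energy is lost where `y_ξ = 0`. -/
structure IsRetained (ν : Measure ℝ) (k : ℝ → ℝ) : Prop where
  measurable : Measurable k
  nonneg : ∀ η, 0 ≤ k η
  le_one : ∀ η, k η ≤ 1
  eq_one : ∀ η, deriv (lag ν) η = 0 → k η = 1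

/-- The retained energy density outside of `{y_ξ = 0}`. -/
noncomputable def densAc (ν : Measure ℝ) (k : ℝ → ℝ) (η : ℝ) : ℝ :=
  k η * dens ν η - densSing ν η

theorem prim_sub_fun {f g : ℝ → ℝ} (hf : Integrable f volume) (hg : Integrable g volume) (ξ : ℝ) :
    prim (fun η => f η - g η) ξ = prim f ξ - prim g ξ :=
  integral_sub hf.integrableOn hg.integrableOn

namespace IsRetained

variable {ν : Measure ℝ} {k : ℝ → ℝ}

theorem densAc_of_deriv_eq_zero (hk : IsRetained ν k) {η : ℝ} (h : deriv (lag ν) η = 0) :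
    densAc ν k η = 0 := by
  rw [densAc, hk.eq_one η h, densSing, indicator_of_mem (show η ∈ {η | deriv (lag ν) η = 0} from h)]
  ring

theorem densAc_of_deriv_ne_zero {η : ℝ} (h : deriv (lag ν) η ≠ 0) :
    densAc ν k η = k η * dens ν η := by
  rw [densAc, densSing, indicator_of_notMem (show η ∉ {η | deriv (lag ν) η = 0} from h), sub_zero]

variable [IsFiniteMeasure ν]

theorem mul_dens_nonneg (hk : IsRetained ν k) (η : ℝ) : 0 ≤ k η * dens ν η :=
  mul_nonneg (hk.nonneg η) (dens_nonneg ν η)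

theorem mul_dens_le (hk : IsRetained ν k) (η : ℝ) : k η * dens ν η ≤ dens ν η :=
  mul_le_of_le_one_left (dens_nonneg ν η) (hk.le_one η)

theorem abs_mul_dens_le (hk : IsRetained ν k) (η : ℝ) : |k η * dens ν η| ≤ 1 := by
  rw [abs_of_nonneg (hk.mul_dens_nonneg η)]
  exact (hk.mul_dens_le η).trans (dens_le_one ν η)

theorem integrable (hk : IsRetained ν k) : Integrable (fun η => k η * dens ν η) volume :=
  (integrable_dens ν).mono' (hk.measurable.mul (measurable_dens ν)).aestronglyMeasurable
    (Eventually.of_forall fun η => by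
      rw [Real.norm_eq_abs, abs_of_nonneg (hk.mul_dens_nonneg η)]
      exact hk.mul_dens_le η)

theorem densAc_nonneg (hk : IsRetained ν k) (η : ℝ) : 0 ≤ densAc ν k η := by
  by_cases h : deriv (lag ν) η = 0
  · exact (hk.densAc_of_deriv_eq_zero h).ge
  · rw [densAc_of_deriv_ne_zero h]
    exact hk.mul_dens_nonneg η

theorem abs_densAc_le (hk : IsRetained ν k) (η : ℝ) : |densAc ν k η| ≤ 1 := by
  rw [abs_of_nonneg (hk.densAc_nonneg η), densAc]
  linarith [densSing_nonneg ν η, hk.mul_dens_le η, dens_le_one ν η]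

theorem integrable_densAc (hk : IsRetained ν k) : Integrable (densAc ν k) volume :=
  hk.integrable.sub (integrable_densSing ν)

theorem prim_densAc (hk : IsRetained ν k) (ξ : ℝ) :
    prim (densAc ν k) ξ = prim (fun η => k η * dens ν η) ξ - prim (densSing ν) ξ :=
  prim_sub_fun hk.integrable (integrable_densSing ν) ξ

/-- The energy lost between `ξ` and a later point within a cell is at most the absolutely
continuous energy of the cell. -/
theorem loss_bounds (hk : IsRetained ν k) {x z ξ : ℝ} (h1 : x + cumul ν x ≤ ξ)
    (h2 : ξ ≤ z + cumul ν z) :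
    0 ≤ (lagH ν ξ - prim (fun η => k η * dens ν η) ξ)
        - (cumul ν x - prim (fun η => k η * dens ν η) (x + cumul ν x)) ∧
      (lagH ν ξ - prim (fun η => k η * dens ν η) ξ)
        - (cumul ν x - prim (fun η => k η * dens ν η) (x + cumul ν x)) ≤
        cumul (acPart ν) z - cumul (acPart ν) x := by
  have hm : Monotone fun ξ => lagH ν ξ - prim (fun η => k η * dens ν η) ξ := by
    have h := prim_mono ((integrable_dens ν).sub hk.integrable)
      fun η => sub_nonneg.2 (hk.mul_dens_le η)
    intro a b hab
    have h3 := h hab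
    rw [← prim_dens]
    simp only
    rwa [← prim_sub_fun (integrable_dens ν) hk.integrable,
      ← prim_sub_fun (integrable_dens ν) hk.integrable]
  have h3 := hm h1
  have h4 := hm h2
  -- The retained energy gained across the cell is at least its singular energy, so the loss cannot
  -- exceed the absolutely continuous part.
  have h5 := prim_mono hk.integrable_densAc hk.densAc_nonneg (h1.trans h2)
  rw [hk.prim_densAc, hk.prim_densAc, prim_densSing, prim_densSing] at h5
  simp only [lagH_add_cumul] at h3 h4
  have h6 := cumul_acPart_add_singPart ν x
  have h7 := cumul_acPart_add_singPart ν z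
  constructor <;> linarith

section Comp

variable {φ : ℝ → ℝ} {L : NNReal}

/-- If (y∘φ)' = y_ξ(φ)φ' vanishes, either factor kills `densAc`(φ)φ'; if not, y_ξ(φ) ≠ 0, where the
two densities coincide. -/
theorem ae_deriv_comp (hk : IsRetained ν k) (hφ : LipschitzWith L φ) (hφm : Monotone φ) :
    ∀ᵐ r, (HasDerivAt (lag ν ∘ φ) 0 r → deriv (prim (densAc ν k) ∘ φ) r = 0) ∧
      (¬ HasDerivAt (lag ν ∘ φ) 0 r → deriv (prim (fun η => k η * dens ν η) ∘ φ) r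
        = deriv (prim (densAc ν k) ∘ φ) r) := by
  filter_upwards [ae_hasDerivAt_comp (lag_lipschitz ν) hφ hφm,
    prim_comp_ae_hasDerivAt hk.integrable hk.abs_mul_dens_le hφ hφm,
    prim_comp_ae_hasDerivAt hk.integrable_densAc hk.abs_densAc_le hφ hφm] with r h1 h2 h3
  refine ⟨fun h => ?_, fun h => ?_⟩
  · rcases mul_eq_zero.1 (h1.unique h) with h4 | h4
    · rw [h3.deriv, hk.densAc_of_deriv_eq_zero h4, zero_mul]
    · rw [h3.deriv, h4, mul_zero]
  · have h4 : deriv (lag ν) (φ r) ≠ 0 := fun h4 => h (by simpa [h4] using h1)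
    rw [h2.deriv, h3.deriv, densAc_of_deriv_ne_zero h4]

theorem integral_deriv_comp (hk : IsRetained ν k) (hφ : LipschitzWith L φ) (hφm : Monotone φ)
    (hbot : Tendsto φ atBot atBot) (htop : Tendsto φ atTop atTop) :
    Integrable (deriv (prim (densAc ν k) ∘ φ)) volume ∧
      (∀ r, ∫ x in Iic r, deriv (prim (densAc ν k) ∘ φ) x = prim (densAc ν k) (φ r)) ∧
      ∀ r, ∫ x in Ioi r, deriv (prim (densAc ν k) ∘ φ) x =
        (∫ η, densAc ν k η) - prim (densAc ν k) (φ r) :=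
  integral_deriv_of_monotone_lipschitz
    ((prim_lipschitz hk.integrable_densAc hk.abs_densAc_le).comp hφ)
    ((prim_mono hk.integrable_densAc hk.densAc_nonneg).comp hφm)
    ((prim_tendsto_atBot hk.integrable_densAc).comp hbot)
    ((prim_tendsto_atTop hk.integrable_densAc).comp htop)

end Comp

theorem integral_deriv (hk : IsRetained ν k) :
    Integrable (deriv (prim fun η => k η * dens ν η)) volume ∧
      (∀ r, ∫ x in Iic r, deriv (prim fun η => k η * dens ν η) x
        = prim (fun η => k η * dens ν η) r) ∧
      ∀ r, ∫ x in Ioi r, deriv (prim fun η => k η * dens ν η) x =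
        (∫ η, k η * dens ν η) - prim (fun η => k η * dens ν η) r :=
  integral_deriv_of_monotone_lipschitz (prim_lipschitz hk.integrable hk.abs_mul_dens_le)
    (prim_mono hk.integrable hk.mul_dens_nonneg) (prim_tendsto_atBot hk.integrable)
    (prim_tendsto_atTop hk.integrable)

end IsRetained

/-! ### Comparison of two energies at a fixed time -/

section Comparison

variable {μ ν : Measure ℝ} [IsFiniteMeasure μ] [IsFiniteMeasure ν] {k l : ℝ → ℝ}

theorem integral_deriv_sub (hk : IsRetained μ k) (hl : IsRetained ν l) (ξ : ℝ) :
    Integrable (fun η => deriv (prim fun η => k η * dens μ η) η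
        - deriv (prim fun η => l η * dens ν η) η) volume ∧
      (∫ η in Iic ξ, (deriv (prim fun η => k η * dens μ η) η
          - deriv (prim fun η => l η * dens ν η) η))
        - ∫ η in Ioi ξ, (deriv (prim fun η => k η * dens μ η) η
          - deriv (prim fun η => l η * dens ν η) η)
      = 2 * (prim (fun η => k η * dens μ η) ξ - prim (fun η => l η * dens ν η) ξ)
        - ((∫ η, k η * dens μ η) - ∫ η, l η * dens ν η) := by
  obtain ⟨h1, h2, h3⟩ := hk.integral_deriv
  obtain ⟨h4, h5, h6⟩ := hl.integral_deriv
  refine ⟨h1.sub h4, ?_⟩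
  rw [integral_sub h1.integrableOn h4.integrableOn, integral_sub h1.integrableOn h4.integrableOn,
    h2, h3, h5, h6]
  ring

theorem abs_integral_Iic_sub_integral_Ioi_le (D : ℝ → ℝ) (r : ℝ) :
    ENNReal.ofReal |(∫ x in Iic r, D x) - ∫ x in Ioi r, D x| ≤ ∫⁻ x, ‖D x‖ₑ := by
  rw [← Real.enorm_eq_ofReal_abs]
  refine enorm_sub_le.trans ((add_le_add (enorm_integral_le_lintegral_enorm _)
    (enorm_integral_le_lintegral_enorm _)).trans_eq ?_)
  rw [← compl_Iic, lintegral_add_compl _ measurableSet_Iic]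

theorem measurableSet_zeroDerivSet (Y : ℝ → ℝ) : MeasurableSet (zeroDerivSet Y) := by
  have h : zeroDerivSet Y = {r | DifferentiableAt ℝ Y r} ∩ deriv Y ⁻¹' {0} := by
    ext r
    exact ⟨fun h => ⟨HasDerivAt.differentiableAt h, HasDerivAt.deriv h⟩,
      fun ⟨h1, h2⟩ => by
        have h3 := h1.hasDerivAt
        rwa [show deriv Y r = 0 from h2] at h3⟩
  rw [h]
  exact (measurableSet_of_differentiableAt ℝ Y).inter
    (measurable_deriv Y (measurableSet_singleton 0))

/-- The comparison at a point where the cumulative energies agree. -/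
theorem energy_le_of_crossing (hk : IsRetained μ k) (hl : IsRetained ν l)
    (hs : ∫ η, densSing μ η = ∫ η, densSing ν η) {x : ℝ} (hx : cumul μ x = cumul ν x)
    (hxs : cumul (singPart μ) x = cumul (singPart ν) x) :
    ENNReal.ofReal |2 * (prim (fun η => k η * dens μ η) (x + cumul μ x)
        - prim (fun η => l η * dens ν η) (x + cumul μ x))
        - ((∫ η, k η * dens μ η) - ∫ η, l η * dens ν η)| ≤
      eLpNorm (fun r => deriv (prim (fun η => k η * dens μ η) ∘ phi (lag μ) (lag ν)) r
        - deriv (prim (fun η => l η * dens ν η) ∘ psi (lag μ) (lag ν)) r) 1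
        (volume.restrict (zeroDerivSet (lag μ ∘ phi (lag μ) (lag ν)))ᶜ) := by
  set φ := phi (lag μ) (lag ν) with hφ
  set ψ := psi (lag μ) (lag ν) with hψ
  set ℬ := zeroDerivSet (lag μ ∘ φ) with hℬ
  -- Hence the single set ℬ serves both solutions.
  have hcomp : lag μ ∘ φ = lag ν ∘ ψ := funext lag_phi
  obtain ⟨i1, i2, i3⟩ := hk.integral_deriv_comp (φ := φ) phi_lipschitz phi_mono
    (tendsto_atBot_of_abs_sub_le abs_phi_sub_le) (tendsto_atTop_of_abs_sub_le abs_phi_sub_le)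
  obtain ⟨j1, j2, j3⟩ := hl.integral_deriv_comp (φ := ψ) psi_lipschitz psi_mono
    (tendsto_atBot_of_abs_sub_le abs_psi_sub_le) (tendsto_atTop_of_abs_sub_le abs_psi_sub_le)
  set D : ℝ → ℝ := fun r => deriv (prim (densAc μ k) ∘ φ) r - deriv (prim (densAc ν l) ∘ ψ) r
    with hD
  have e1 : ∫ η, densAc μ k η = (∫ η, k η * dens μ η) - ∫ η, densSing μ η :=
    integral_sub hk.integrable (integrable_densSing μ)
  have e2 : ∫ η, densAc ν l η = (∫ η, l η * dens ν η) - ∫ η, densSing ν η :=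
    integral_sub hl.integrable (integrable_densSing ν)
  have e3 := prim_densSing μ x
  have e4 := prim_densSing ν x
  rw [← hx] at e4
  -- The singular contributions cancel, both up to the crossing and in total, leaving only `densAc`,
  -- whose integrals are unchanged by the substitutions.
  have key : 2 * (prim (fun η => k η * dens μ η) (x + cumul μ x)
        - prim (fun η => l η * dens ν η) (x + cumul μ x))
        - ((∫ η, k η * dens μ η) - ∫ η, l η * dens ν η)
      = (∫ r in Iic (x + cumul μ x), D r) - ∫ r in Ioi (x + cumul μ x), D r := by
    rw [hD, integral_sub i1.integrableOn j1.integrableOn,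
      integral_sub i1.integrableOn j1.integrableOn, i2, i3, j2, j3,
      hφ, hψ, phi_add_cumul hx, psi_add_cumul hx, hk.prim_densAc, hl.prim_densAc]
    linarith
  rw [key]
  refine (abs_integral_Iic_sub_integral_Ioi_le D _).trans ?_
  have hBm : MeasurableSet ℬ := measurableSet_zeroDerivSet _
  have a1 := hk.ae_deriv_comp (φ := φ) phi_lipschitz phi_mono
  have a2 := hl.ae_deriv_comp (φ := ψ) psi_lipschitz psi_mono
  rw [← hcomp] at a2
  have h0 : ∫⁻ r in ℬ, ‖D r‖ₑ = 0 := by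
    refine (setLIntegral_congr_fun_ae hBm (g := 0) ?_).trans (by simp)
    filter_upwards [a1, a2] with r h1 h2 hr
    simp [hD, h1.1 hr, h2.1 hr]
  rw [← lintegral_add_compl _ hBm, h0, zero_add, eLpNorm_one_eq_lintegral_enorm]
  refine (setLIntegral_congr_fun_ae hBm.compl ?_).le
  filter_upwards [a1, a2] with r h1 h2 hr
  rw [hD, h1.2 hr, h2.2 hr]

/-- The comparison of the energies at a fixed time, for measures whose cumulative functions agree
on a grid of size `c`. -/
theorem energy_le (hk : IsRetained μ k) (hl : IsRetained ν l) {c : ℝ} (hc : 0 < c)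
    (hF : ∀ j : ℤ, cumul μ (j * c) = cumul ν (j * c))
    (hS : ∀ j : ℤ, cumul (singPart μ) (j * c) = cumul (singPart ν) (j * c)) {E : ℝ≥0∞}
    (hE : ∀ x, ENNReal.ofReal (cumul (acPart μ) (x + c) - cumul (acPart μ) x) ≤ E) (ξ : ℝ) :
    ENNReal.ofReal |2 * (prim (fun η => k η * dens μ η) ξ - prim (fun η => l η * dens ν η) ξ)
        - ((∫ η, k η * dens μ η) - ∫ η, l η * dens ν η)| ≤
      ENNReal.ofReal (2 * c) + 2 * E +
      eLpNorm (fun r => deriv (prim (fun η => k η * dens μ η) ∘ phi (lag μ) (lag ν)) r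
        - deriv (prim (fun η => l η * dens ν η) ∘ psi (lag μ) (lag ν)) r) 1
        (volume.restrict (zeroDerivSet (lag μ ∘ phi (lag μ) (lag ν)))ᶜ) := by
  -- The total singular energies are limits along the grid, where the cumulative functions agree.
  have hs : ∫ η, densSing μ η = ∫ η, densSing ν η := by
    have hgrid : Tendsto (fun n : ℕ => ((n : ℤ) : ℝ) * c + cumul μ (((n : ℤ) : ℝ) * c)) atTop
        atTop := by
      refine tendsto_atTop_mono (fun n => le_add_of_nonneg_right (cumul_nonneg μ _)) ?_
      exact (tendsto_intCast_atTop_atTop.comp tendsto_natCast_atTop_atTop).atTop_mul_const hc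
    refine tendsto_nhds_unique ((prim_tendsto_atTop (integrable_densSing μ)).comp hgrid) ?_
    refine ((prim_tendsto_atTop (integrable_densSing ν)).comp hgrid).congr fun n => ?_
    simp only [Function.comp_apply]
    rw [prim_densSing, hF, prim_densSing, hS]
  set j := ⌊lag μ ξ / c⌋ with hj
  have b1 : j * c ≤ lag μ ξ := (le_div_iff₀ hc).1 (Int.floor_le _)
  have b2 : lag μ ξ < j * c + c := by
    have := (div_lt_iff₀ hc).1 (Int.lt_floor_add_one (lag μ ξ / c))
    linarith
  set x := (j : ℝ) * c with hx
  have hx' : ((j + 1 : ℤ) : ℝ) * c = x + c := by push_cast; ring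
  have f1 : cumul μ x = cumul ν x := hF j
  have f2 : cumul μ (x + c) = cumul ν (x + c) := by rw [← hx']; exact hF _
  have s1 : cumul (singPart μ) x = cumul (singPart ν) x := hS j
  have s2 : cumul (singPart μ) (x + c) = cumul (singPart ν) (x + c) := by rw [← hx']; exact hS _
  have c1 := (le_lag_iff μ).1 b1
  have c2 := (lag_lt_iff μ).1 b2
  -- Membership of y(ξ) in a cell depends only on F at its endpoints, so it transfers to the other
  -- measure.
  have d1 : x ≤ lag ν ξ := (le_lag_iff ν).2 (f1 ▸ c1)
  have d2 : lag ν ξ < x + c := (lag_lt_iff ν).2 (f2 ▸ c2)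
  have l1 := hk.loss_bounds c1 c2.le
  have l2 := hl.loss_bounds (f1 ▸ c1) (f2 ▸ c2.le)
  rw [← f1] at l2
  have g1 := cumul_acPart_add_singPart μ x
  have g2 := cumul_acPart_add_singPart μ (x + c)
  have g3 := cumul_acPart_add_singPart ν x
  have g4 := cumul_acPart_add_singPart ν (x + c)
  set e := cumul (acPart μ) (x + c) - cumul (acPart μ) x with he
  have hcross := energy_le_of_crossing hk hl hs f1 s1
  have he0 : 0 ≤ e := l1.1.trans l1.2
  unfold lagH at l1 l2
  set V := prim fun η => k η * dens μ η with hV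
  set W := prim fun η => l η * dens ν η with hW
  set T := (∫ η, k η * dens μ η) - ∫ η, l η * dens ν η with hT
  -- Between the crossing and ξ, the change of V - W is ŷ - y plus a difference of two losses in [0,
  -- e]: at most c + e, then doubled. The cell energy e is the same for both measures.
  have hfinal : |2 * (V ξ - W ξ) - T| ≤
      2 * c + 2 * e + |2 * (V (x + cumul μ x) - W (x + cumul μ x)) - T| := by
    have h1 : 2 * (V ξ - W ξ) - T = 2 * ((V ξ - W ξ) - (V (x + cumul μ x) - W (x + cumul μ x)))
      + (2 * (V (x + cumul μ x) - W (x + cumul μ x)) - T) := by ring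
    rw [h1]
    refine (abs_add_le _ _).trans (add_le_add_left ?_ _)
    rw [abs_le]
    constructor <;> linarith [l1.1, l1.2, l2.1, l2.2]
  refine (ENNReal.ofReal_le_ofReal hfinal).trans ?_
  rw [ENNReal.ofReal_add (by positivity) (abs_nonneg _),
    ENNReal.ofReal_add (by positivity) (by positivity)]
  refine add_le_add (add_le_add le_rfl ?_) hcross
  rw [ENNReal.ofReal_mul zero_le_two, ENNReal.ofReal_ofNat]
  exact mul_le_mul_right (hE x) 2

end Comparison

/-! ### `α`-dissipative solutions -/

theorem measurable_waveBreaking (Xbar : LagrData) : Measurable (waveBreaking Xbar) := by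
  unfold waveBreaking
  have h1 := measurable_deriv Xbar.y
  have h2 := measurable_deriv Xbar.U
  refine Measurable.ite ((h1 (measurableSet_singleton 0)).inter (h2 (measurableSet_singleton 0)))
    measurable_const (Measurable.ite (h2 measurableSet_Iio) ?_ measurable_const)
  exact (((h1.const_mul 2).div h2).neg).ennreal_ofReal

/-- The fraction of the initial energy that is retained at time `t`. -/
noncomputable def retained (α : ℝ → ℝ) (Xbar : LagrData) (X : ℝ → LagrData) (t η : ℝ) : ℝ :=
  1 - α ((X (waveBreaking Xbar η).toReal).y η) *
    indicator {ω | 0 < waveBreaking Xbar ω ∧ waveBreaking Xbar ω ≤ ENNReal.ofReal t} 1 η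

namespace IsAlphaSolution

variable {α : ℝ → ℝ} {Xbar : LagrData} {X : ℝ → LagrData}

theorem isRetained (hX : IsAlphaSolution α Xbar X) (hα : IsDissipationCoeff α) {ν : Measure ℝ}
    (hy : Xbar.y = lag ν) (t : ℝ) : IsRetained ν (retained α Xbar X t) := by
  have hτ := measurable_waveBreaking Xbar
  have hS : MeasurableSet
      {ω | 0 < waveBreaking Xbar ω ∧ waveBreaking Xbar ω ≤ ENNReal.ofReal t} :=
    (hτ measurableSet_Ioi).inter (hτ measurableSet_Iic)
  have hind (η : ℝ) : 0 ≤ indicator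
      {ω | 0 < waveBreaking Xbar ω ∧ waveBreaking Xbar ω ≤ ENNReal.ofReal t} (1 : ℝ → ℝ) η ∧
      indicator {ω | 0 < waveBreaking Xbar ω ∧ waveBreaking Xbar ω ≤ ENNReal.ofReal t}
        (1 : ℝ → ℝ) η ≤ 1 :=
    ⟨indicator_nonneg (fun _ _ => zero_le_one) η, indicator_le_self' (fun _ _ => zero_le_one) η⟩
  refine ⟨?_, fun η => ?_, fun η => ?_, fun η hη => ?_⟩
  · have h1 := measurable_uncurry_of_differentiable_on_nonneg hX.continuous_y hX.y_eq
    have h2 : Measurable fun η => (X (waveBreaking Xbar η).toReal).y η := by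
      have h3 := h1.comp (hτ.ennreal_toReal.prodMk measurable_id)
      convert h3 using 2 with η
      simp
    obtain ⟨K, hK⟩ := hα.1
    exact measurable_const.sub ((hK.continuous.measurable.comp h2).mul
      (measurable_one.indicator hS))
  · have h1 := hα.2 ((X (waveBreaking Xbar η).toReal).y η)
    have := mul_le_one₀ h1.2.le (hind η).1 (hind η).2
    unfold retained
    linarith
  · have h1 := hα.2 ((X (waveBreaking Xbar η).toReal).y η)
    have := mul_nonneg h1.1 (hind η).1
    unfold retained
    linarith
  · have h0 : η ∉ {ω | 0 < waveBreaking Xbar ω ∧ waveBreaking Xbar ω ≤ ENNReal.ofReal t} := by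
      rintro ⟨h1, h2⟩
      rw [← hy] at hη
      unfold waveBreaking at h1 h2
      split_ifs at h1 h2
      · exact lt_irrefl _ h1
      -- With y_ξ = 0 and U_ξ < 0 the formula gives τ = 0; in the remaining case τ = ∞. Neither
      -- satisfies 0 < τ ≤ t, so nothing is lost.
      · simp [hη] at h1
      · exact absurd h2 (by simp)
    rw [retained, indicator_of_notMem h0, mul_zero, sub_zero]

/-- Energy is only removed as time passes; this monotonicity gives integrability in time without
further regularity. -/
theorem retained_antitone (hα : IsDissipationCoeff α) (η : ℝ) :
    Antitone fun t => retained α Xbar X t η := fun s t hst => by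
  have h1 := hα.2 ((X (waveBreaking Xbar η).toReal).y η)
  refine sub_le_sub_left (mul_le_mul_of_nonneg_left ?_ h1.1) 1
  have h2 : {ω | 0 < waveBreaking Xbar ω ∧ waveBreaking Xbar ω ≤ ENNReal.ofReal s} ⊆
      {ω | 0 < waveBreaking Xbar ω ∧ waveBreaking Xbar ω ≤ ENNReal.ofReal t} :=
    fun ω hω => ⟨hω.1, hω.2.trans (ENNReal.ofReal_le_ofReal hst)⟩
  exact indicator_le_indicator_of_subset h2 (fun _ => zero_le_one) η

theorem V_eq_prim (hX : IsAlphaSolution α Xbar X) {ν : Measure ℝ} (hV : Xbar.V = lagH ν) {t : ℝ}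
    (ht : 0 ≤ t) : (X t).V = prim fun η => retained α Xbar X t η * dens ν η := by
  ext ξ
  rw [hX.V_eq ξ t ht, hV]
  rfl

theorem setIntegral_antitone (hX : IsAlphaSolution α Xbar X) (hα : IsDissipationCoeff α)
    {ν : Measure ℝ} [IsFiniteMeasure ν] (hy : Xbar.y = lag ν) (s : Set ℝ) :
    Antitone fun t => ∫ η in s, retained α Xbar X t η * dens ν η := fun a b hab =>
  integral_mono (hX.isRetained hα hy b).integrable.integrableOn
    (hX.isRetained hα hy a).integrable.integrableOn
    fun η => mul_le_mul_of_nonneg_right (retained_antitone hα η hab) (dens_nonneg ν η)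

end IsAlphaSolution

/-- Only the constant summand has to be measurable to split the upper integral, so L can be
arbitrary. -/
theorem ofReal_abs_integral_le {g : ℝ → ℝ} {C : ℝ≥0∞} {L : ℝ → ℝ≥0∞} {t : ℝ} (ht : 0 ≤ t)
    (h : ∀ s ∈ Icc 0 t, ENNReal.ofReal |g s| ≤ C + L s) :
    ENNReal.ofReal |∫ s in (0 : ℝ)..t, g s| ≤ C * ENNReal.ofReal t + ∫⁻ s in Icc 0 t, L s := by
  rw [intervalIntegral.integral_of_le ht, ← integral_Icc_eq_integral_Ioc,
    ← Real.enorm_eq_ofReal_abs]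
  refine (enorm_integral_le_lintegral_enorm _).trans ?_
  refine (setLIntegral_mono' measurableSet_Icc (g := fun s => C + L s) fun s hs => ?_).trans_eq ?_
  · rw [Real.enorm_eq_ofReal_abs]
    exact h s hs
  · rw [lintegral_add_left measurable_const, setLIntegral_const, Real.volume_Icc, sub_zero]

end HunterSaxton

/-! ### The stability estimate -/

open HunterSaxton in
theorem theorem3p7 (α : ℝ → ℝ) (hα : IsDissipationCoeff α)
    (d : EulerData) (hd : d.MemD0)
    (Δx : ℝ) (hΔx : 0 < Δx) (σ : ℤ → ℤˣ)
    (Xbar Xbarh : LagrData) (hXbar : Xbar = d.toLagr) (hXbarh : Xbarh = (d.proj Δx σ).toLagr)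
    (X Xh : ℝ → LagrData)
    (hX : IsAlphaSolution α Xbar X) (hXh : IsAlphaSolution α Xbarh Xh)
    (φ ψ : ℝ → ℝ) (hφ : φ = phi Xbar.y Xbarh.y) (hψ : ψ = psi Xbar.y Xbarh.y)
    (𝒳 𝒳h : ℝ → LagrData) (h𝒳 : ∀ s, 𝒳 s = (X s).comp φ) (h𝒳h : ∀ s, 𝒳h s = (Xh s).comp ψ)
    (ℬ : Set ℝ) (hℬ : ℬ = zeroDerivSet (Xbar.comp φ).y)
    (t : ℝ) (ht : 0 ≤ t) (ξ : ℝ) :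
    (∀ s ∈ Icc 0 t, Integrable (fun η => deriv (X s).V η - deriv (Xh s).V η) volume) ∧
    IntervalIntegrable
      (fun s => (∫ η in Iic ξ, (deriv (X s).V η - deriv (Xh s).V η))
        - ∫ η in Ioi ξ, (deriv (X s).V η - deriv (Xh s).V η)) volume 0 t ∧
    ENNReal.ofReal
      |∫ s in (0 : ℝ)..t, ((∫ η in Iic ξ, (deriv (X s).V η - deriv (Xh s).V η))
        - ∫ η in Ioi ξ, (deriv (X s).V η - deriv (Xh s).V η))|
      ≤ ENNReal.ofReal (4 * t * Δx)
        + ENNReal.ofReal (4 * t) *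
          eLpNorm (fun x => (deriv d.u (x + 2 * Δx)) ^ 2 - (deriv d.u x) ^ 2) 1 volume
        + ∫⁻ s in Icc 0 t,
            eLpNorm (fun r => deriv (𝒳 s).V r - deriv (𝒳h s).V r) 1 (volume.restrict ℬᶜ) := by
  obtain ⟨hdD, hmn⟩ := hd
  have := hdD.finite_mu
  have := hdD.finite_nu
  have hac := hdD.ac_eq
  have hq := EulerData.diffU_sq_le hdD.u_mem hac hΔx
  have hcumul := EulerData.isCumul_projF (σ := σ) hΔx hq
  set ν := (d.proj Δx σ).nu with hν
  have : IsFiniteMeasure ν := hcumul.isFiniteMeasure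
  have hy : Xbar.y = lag d.mu := by rw [hXbar, hmn]; rfl
  have hyh : Xbarh.y = lag ν := by rw [hXbarh]; rfl
  have hV : Xbar.V = lagH d.mu := by rw [hXbar, toLagr_V hmn, hmn]
  have hVh : Xbarh.V = lagH ν := by rw [hXbarh, toLagr_V rfl]
  have hF (j : ℤ) : cumul d.mu (j * (2 * Δx)) = cumul ν (j * (2 * Δx)) := by
    rw [← mul_assoc, mul_comm (j : ℝ) 2, hν, EulerData.cumul_proj_grid hΔx hq]
  have hS (j : ℤ) :
      cumul (singPart d.mu) (j * (2 * Δx)) = cumul (singPart ν) (j * (2 * Δx)) := by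
    rw [← mul_assoc, mul_comm (j : ℝ) 2, hν, EulerData.cumul_singPart_proj_grid hΔx hq]
  set E := eLpNorm (fun x => (deriv d.u (x + 2 * Δx)) ^ 2 - (deriv d.u x) ^ 2) 1 volume with hE
  have hE' (x : ℝ) : ENNReal.ofReal
      (cumul (acPart d.mu) (x + 2 * Δx) - cumul (acPart d.mu) x) ≤ E := by
    rw [EulerData.cumul_acPart_sub hac]
    exact EulerData.ofReal_integral_le_eLpNorm_shift (EulerData.integrable_deriv_sq hac)
      (by positivity)
  have hk (s : ℝ) := hX.isRetained hα hy s
  have hl (s : ℝ) := hXh.isRetained hα hyh s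
  have hint (s : ℝ) := integral_deriv_sub (hk s) (hl s) ξ
  have hg {s : ℝ} (hs : 0 ≤ s) :
      (∫ η in Iic ξ, (deriv (X s).V η - deriv (Xh s).V η))
        - ∫ η in Ioi ξ, (deriv (X s).V η - deriv (Xh s).V η)
      = 2 * (prim (fun η => retained α Xbar X s η * dens d.mu η) ξ
          - prim (fun η => retained α Xbarh Xh s η * dens ν η) ξ)
        - ((∫ η, retained α Xbar X s η * dens d.mu η)
          - ∫ η, retained α Xbarh Xh s η * dens ν η) := by
    rw [hX.V_eq_prim hV hs, hXh.V_eq_prim hVh hs]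
    exact (hint s).2
  refine ⟨fun s hs => ?_, ?_, ?_⟩
  · rw [hX.V_eq_prim hV hs.1, hXh.V_eq_prim hVh hs.1]
    exact (hint s).1
  -- Each of the four energies is antitone in time, hence interval integrable.
  · have h1 := (hX.setIntegral_antitone hα hy (Iic ξ)).intervalIntegrable (μ := volume) (a := 0)
      (b := t)
    have h2 := (hXh.setIntegral_antitone hα hyh (Iic ξ)).intervalIntegrable (μ := volume) (a := 0)
      (b := t)
    have h3 := (hX.setIntegral_antitone hα hy univ).intervalIntegrable (μ := volume) (a := 0)
      (b := t)
    have h4 := (hXh.setIntegral_antitone hα hyh univ).intervalIntegrable (μ := volume) (a := 0)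
      (b := t)
    simp only [setIntegral_univ] at h3 h4
    refine IntervalIntegrable.congr (fun s hs => ?_) (((h1.sub h2).const_mul 2).sub (h3.sub h4))
    rw [uIoc_of_le ht] at hs
    exact (hg hs.1.le).symm
  · have h := ofReal_abs_integral_le (C := ENNReal.ofReal (2 * (2 * Δx)) + 2 * E) ht
      (g := fun s => (∫ η in Iic ξ, (deriv (X s).V η - deriv (Xh s).V η))
        - ∫ η in Ioi ξ, (deriv (X s).V η - deriv (Xh s).V η))
      (L := fun s => eLpNorm (fun r => deriv (𝒳 s).V r - deriv (𝒳h s).V r) 1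
        (volume.restrict ℬᶜ)) fun s hs => by
          rw [hg hs.1, h𝒳, h𝒳h, hℬ, hφ, hψ]
          simp only [LagrData.comp]
          rw [hX.V_eq_prim hV hs.1, hXh.V_eq_prim hVh hs.1, hy, hyh]
          exact energy_le (hk s) (hl s) (by positivity) hF hS hE' ξ
    refine h.trans (add_le_add_left ?_ _)
    rw [add_mul]
    refine add_le_add (le_of_eq ?_) ?_
    · rw [← ENNReal.ofReal_mul (by positivity)]
      congr 1
      ring
    -- The argument yields the factor 2 in front of the shift norm, which is relaxed to 4.
    · rw [ENNReal.ofReal_mul (by norm_num), mul_right_comm]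
      gcongr
      simp only [ENNReal.ofReal_ofNat]
      norm_num
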